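/- **Setting.** CountSketch with parameters $(n,\ell,b)$ has randomness $\rho$: independent, fully random hash functions $h_j:[n]\to[b]$ and sign functions $s_j:[n]\to\{-1,1\}$, $j\in[\ell]$. Its measurement vectors are $\mu^{(j,k)}_i=\mathbf 1\{h_j(i)=k\}\,s_j(i)$, and $\mathrm{Sketch}_\rho(\boldsymbol v)=(\langle\boldsymbol\mu^{(j,k)},\boldsymbol v\rangle)_{j\in[\ell],k\in[b]}$. For a key $i$, the average adjusted measurement is $\overline{\mathrm{adj}}_{\rho,i}(\boldsymbol v)=\frac1\ell\sum_{j}\langle\boldsymbol\mu^{(j,h_j(i))},\boldsymbol v\rangle\,\mu^{(j,h_j(i))}_i$. **Attack.** Let $\sigma=\sqrt{m/b}$ and $0<a<c$. Draw a key $h$ uniformly from $[n]$ and random pairwise disjoint sets $S_1,\dots,S_r\subset[n]\setminus\{h\}$ of size $m$ (uniformly); $\boldsymbol z^{(t)}$ has i.i.d. Rademacher entries on $S_t$ and is $0$ elsewhere. Draw $v^{(t)}_h$ i.i.d. uniformly from $[a\sigma,(c+2a)\sigma]$ and issue the queries $\boldsymbol v^{(t)}=v^{(t)}_h\boldsymbol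 e_h+\boldsymbol z^{(t)}$. At step $t$ a query-response algorithm chooses an estimator, arbitrarily as a (jointly measurable) function of its internal randomness, $\rho$, $h$ and all earlier queries and responses, and applies it to $\mathrm{Sketch}_\rho(\boldsymbol v^{(t)})$; the result is a set of keys $K^{(t)}$. Put $s^{(t)}=1$ if $h\in K^{(t)}$ and $s^{(t)}=-1$ otherwise. The output is $\boldsymbol z^{(A)}=\sum_{t=1}^r s^{(t)}\boldsymbol z^{(t)}$. The sketch randomness, the pair of the key and the supports, the signs, the values $v_h^{(t)}$ and the internal randomness of the algorithm are independent. The algorithm is *$(a,c,\delta)$-correct* if for every step $t$ and every real $x$, when the value of $h$ in the $t$-th query is set to $x$ (everything else being random as above), $\Pr[h\in K^{(t)}]\ge 1-\delta$ if $x\ge c\sigma$, and $\Pr[h\in K^{(t)}]\le\delta$ if $|x|\le a\sigma$. **Theorem (Adversarial input).** Let $\ell,b\ge1$ be integers, $B>1$, $0<a<c$, let $r=B\ell^2$ be an integer, and let $\varepsilon>0$. There is $m_0$, depending only on $\ell,b,B,a,c,\varepsilon$, such that for all $m\ge m_0$, all $n\ge rm+1$, all $\delta$ and every $(a,c,\delta)$-correct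 query-response algorithm, almost surely $z^{(A)}_h=0$ and $\|\boldsymbol z^{(A)}\|_2=\sqrt{rm}$, and, with $X=\overline{\mathrm{adj}}_{\rho,h}(\boldsymbol z^{(A)})$ (same $\rho$ as in the attack; $X$ is square integrable), $q=4\sqrt{B\ell\delta}/(c+a)$, $$\Big|\mathsf E[X]-\tfrac{2}{c+a}\sqrt{\tfrac Bb}\,\|\boldsymbol z^{(A)}\|_2\Big|\le(2\delta+\varepsilon)\cdot\tfrac{2}{c+a}\sqrt{\tfrac Bb}\,\|\boldsymbol z^{(A)}\|_2,$$ $$\Big|\mathsf{Var}[X]-\tfrac{1}{\ell b}\|\boldsymbol z^{(A)}\|_2^2\Big|\le\Big(\tfrac{4}{\ell(c+a)^2}+2q+q^2+\varepsilon\Big)\cdot\tfrac{1}{\ell b}\|\boldsymbol z^{(A)}\|_2^2 .$$ Thus both quantities agree with $\frac{2}{c+a}\sqrt{B/b}\,\|\boldsymbol z^{(A)}\|_2$ and $\frac1{\ell b}\|\boldsymbol z^{(A)}\|_2^2$ up to a small relative error when $m$ is large, $\ell(c+a)^2$ is large and $\delta$ is small (for the variance: $B\ell\delta$ small compared with $(c+a)^2$).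 In contrast, for a fresh sketch randomness $\rho'$ independent of the attack, $X'=\overline{\mathrm{adj}}_{\rho',h}(\boldsymbol z^{(A)})$ is square integrable with $\mathsf E[X']=0$ and $\mathsf{Var}[X']=\frac{1}{\ell b}\|\boldsymbol z^{(A)}\|_2^2$. -/

import Mathlib

open MeasureTheory ProbabilityTheory Set

universe u

noncomputable section

namespace CountSketch

/-- The sign encoded by a bit. A uniformly random bit gives a Rademacher variable. -/
def sgn (s : Bool) : ℝ := if s then 1 else -1

/-! ### The sketch -/

/-- Internal randomness `ρ` of CountSketch with parameters `(n, ℓ, b)`: for each row `j`, the hash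
function `h_j : [n] → [b]` and the sign function `s_j : [n] → {-1, 1}` (as bits). -/
abbrev Randomness (n ℓ b : ℕ) : Type := Fin ℓ → (Fin n → Fin b) × (Fin n → Bool)

/-- The distribution of `ρ`: all hash values and all signs are independent and uniform. -/
def randomnessLaw (n ℓ b : ℕ) : Measure (Randomness n ℓ b) := uniformOn Set.univ

/-- The measurement vector `μ^{(j,k)}`, with entries `1{h_j(i) = k} s_j(i)`. -/
def measVec {n ℓ b : ℕ} (ρ : Randomness n ℓ b) (j : Fin ℓ) (k : Fin b) : Fin n → ℝ :=
  fun i => if (ρ j).1 i = k then sgn ((ρ j).2 i) else 0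

/-- `Sketch_ρ(v)`: the `ℓ × b` table of the measurements `⟨μ^{(j,k)}, v⟩`. -/
def sketch {n ℓ b : ℕ} (ρ : Randomness n ℓ b) (v : Fin n → ℝ) : Fin ℓ → Fin b → ℝ :=
  fun j k => measVec ρ j k ⬝ᵥ v

/-- The average over the rows `j` of the adjusted measurements
`⟨μ^{(j,h_j(i))}, v⟩ · μ^{(j,h_j(i))}_i` of key `i`. -/
def avgAdjusted {n ℓ b : ℕ} (ρ : Randomness n ℓ b) (i : Fin n) (v : Fin n → ℝ) : ℝ :=
  (1 / (ℓ : ℝ)) * ∑ j, sketch ρ v j ((ρ j).1 i) * measVec ρ j ((ρ j).1 i) i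

/-! ### Query-response algorithms -/

/-- A (randomized, adaptive, state-maintaining) query-response algorithm answering `r` queries.
All its internal randomness is collected in a seed. At step `t` it chooses an estimator, that is, a
map from sketches to sets of keys; the choice may depend on the seed, on `ρ`, on the special key,
and on all previous queries and responses. -/
structure QueryResponse (n ℓ b r : ℕ) where
  Seed : Type u
  [seedMeasurable : MeasurableSpace Seed]
  seedLaw : Measure Seed
  [seedProb : IsProbabilityMeasure seedLaw]
  estimator : (t : Fin r) → Seed → Randomness n ℓ b → Fin n →
    (Set.Iio t → (Fin n → ℝ) × Finset (Fin n)) → (Fin ℓ → Fin b → ℝ) → Finset (Fin n)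
  measurable_estimator : ∀ t : Fin r, Measurable
    fun p : Seed × Randomness n ℓ b × Fin n × (Set.Iio t → (Fin n → ℝ) × Finset (Fin n)) ×
        (Fin ℓ → Fin b → ℝ) =>
      estimator t p.1 p.2.1 p.2.2.1 p.2.2.2.1 p.2.2.2.2

attribute [instance] QueryResponse.seedMeasurable QueryResponse.seedProb

/-- The response `K^{(t)}` to the `t`-th of the queries `q`: the estimator chosen at step `t` is
applied to the sketch of `q t`. -/
def QueryResponse.response {n ℓ b r : ℕ} (A : QueryResponse n ℓ b r) (seed : A.Seed)
    (ρ : Randomness n ℓ b) (h : Fin n) (q : Fin r → Fin n → ℝ) (t : Fin r) : Finset (Fin n) :=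
  A.estimator t seed ρ h (fun i : Set.Iio t => (q i.1, A.response seed ρ h q i.1))
    (sketch ρ (q t))
termination_by t.val
decreasing_by exact i.2

/-! ### The attack -/

/-- The possible special keys `h` and supports of the tails: pairwise disjoint sets of `m` keys
that do not contain `h`. -/
def supports (n m r : ℕ) : Set (Fin n × (Fin r → Finset (Fin n))) :=
  {p | (∀ t, (p.2 t).card = m ∧ p.1 ∉ p.2 t) ∧ Pairwise fun t t' => Disjoint (p.2 t) (p.2 t')}

/-- The scale `σ = √(m / b)`. -/
def scale (m b : ℕ) : ℝ := √((m : ℝ) / (b : ℝ))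

/-- Everything that is drawn at random in one run of the attack. -/
structure Run {n ℓ b r : ℕ} (A : QueryResponse n ℓ b r) where
  /-- the sketch randomness -/
  ρ : Randomness n ℓ b
  /-- the special key -/
  h : Fin n
  /-- the supports of the tails -/
  supp : Fin r → Finset (Fin n)
  /-- the signs of the entries of the tails -/
  sign : Fin r → Fin n → Bool
  /-- the values of the special key in the queries -/
  val : Fin r → ℝ
  /-- the internal randomness of the query-response algorithm -/
  seed : A.Seed

variable {n ℓ b r : ℕ} {A : QueryResponse n ℓ b r}

/-- A run as the tuple of its components. -/
def Run.toTuple (ω : Run A) :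
    Randomness n ℓ b × (Fin n × (Fin r → Finset (Fin n))) × (Fin r → Fin n → Bool) ×
      (Fin r → ℝ) × A.Seed :=
  (ω.ρ, (ω.h, ω.supp), ω.sign, ω.val, ω.seed)

/-- The run with the given components. -/
def Run.ofTuple (p : Randomness n ℓ b × (Fin n × (Fin r → Finset (Fin n))) ×
    (Fin r → Fin n → Bool) × (Fin r → ℝ) × A.Seed) : Run A :=
  ⟨p.1, p.2.1.1, p.2.1.2, p.2.2.1, p.2.2.2.1, p.2.2.2.2⟩

instance Run.instMeasurableSpace : MeasurableSpace (Run A) :=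
  MeasurableSpace.comap Run.toTuple inferInstance

/-- The law of a run of the attack with tail support size `m` and parameters `a`, `c`. The
following are independent: the sketch randomness; the special key and the supports (uniform among
all possibilities, which is the law obtained by choosing the key uniformly and then one support
after the other, each uniformly among the sets of `m` unused keys); the Rademacher signs; the
values of the special key, which are i.i.d. uniform on `[a σ, (c + 2 a) σ]`; the seed. -/
def runLaw (A : QueryResponse n ℓ b r) (m : ℕ) (a c : ℝ) : Measure (Run A) :=
  Measure.map Run.ofTuple
    ((randomnessLaw n ℓ b).prod ((uniformOn (supports n m r)).prod
      ((uniformOn (Set.univ : Set (Fin r → Fin n → Bool))).prod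
        ((Measure.pi fun _ : Fin r =>
          ProbabilityTheory.cond volume
            (Set.Icc (a * scale m b) ((c + 2 * a) * scale m b))).prod A.seedLaw))))

/-- The tail `z^{(t)}`. -/
def Run.tail (ω : Run A) (t : Fin r) : Fin n → ℝ :=
  fun i => if i ∈ ω.supp t then sgn (ω.sign t i) else 0

/-- The query vector `v^{(t)} = v_h^{(t)} e_h + z^{(t)}`. -/
def Run.query (ω : Run A) (t : Fin r) : Fin n → ℝ :=
  Pi.single ω.h (ω.val t) + ω.tail t

/-- The response `K^{(t)}`. -/
def Run.response (ω : Run A) (t : Fin r) : Finset (Fin n) :=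
  A.response ω.seed ω.ρ ω.h ω.query t

/-- `s^{(t)}`, which is `1` if the special key is reported at step `t` and `-1` otherwise. -/
def Run.s (ω : Run A) (t : Fin r) : ℝ := if ω.h ∈ ω.response t then 1 else -1

/-- The output `z^{(A)} = ∑ t, s^{(t)} z^{(t)}` of the attack. -/
def Run.output (ω : Run A) : Fin n → ℝ := ∑ t, ω.s t • ω.tail t

/-- The same run, with the value of the special key in query `t` replaced by `x`. -/
def Run.setVal (ω : Run A) (t : Fin r) (x : ℝ) : Run A :=
  { ω with val := Function.update ω.val t x }

/-- The probability that the special key is reported at step `t` when its value there is `x`. -/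
def reportProb (A : QueryResponse n ℓ b r) (m : ℕ) (a c : ℝ) (t : Fin r) (x : ℝ) : ℝ :=
  (runLaw A m a c).real {ω | ω.h ∈ (ω.setVal t x).response t}

/-- At every step the special key is reported with probability at least `1 - δ` if its value is at
least `c σ`, and with probability at most `δ` if its value is at most `a σ` in magnitude. -/
def IsCorrect (A : QueryResponse n ℓ b r) (m : ℕ) (a c δ : ℝ) : Prop :=
  ∀ t : Fin r, ∀ x : ℝ,
    (c * scale m b ≤ x → 1 - δ ≤ reportProb A m a c t x) ∧
    (|x| ≤ a * scale m b → reportProb A m a c t x ≤ δ)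

/-- The Euclidean norm. -/
def l2norm (v : Fin n → ℝ) : ℝ := ‖(WithLp.toLp 2 v : EuclideanSpace ℝ (Fin n))‖

end CountSketch

end

noncomputable section

namespace CountSketch

open scoped BigOperators

/-! ### Uniform averages over finite function spaces -/

section FiniteAverages

variable {ι π : Type*} [Fintype ι] [DecidableEq ι] [Fintype π]

/-! Condition on everything except the tail signs z and the key value x of one query. The answer
about the special key is then a fixed ±1 function f of the sketch x·g + ∑ z_i w_i, where g and w_i
are the measurement vectors (patterns) of the special key and of the tail keys. Flipping the sign of
a tail key of pattern p moves the sketch by 2p. Summed over the tail keys of pattern p, this is a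
discrete integration by parts (`card_mul_smoothed_sub`): the correlation of f with the sum of their
signs is about half their number times the change of the mean of f under a shift by 2p. A second
application (`card_mul_abs_weighted_sub_le`) shows that moving the base point changes such a
correlation only by O(1), so shifts by several patterns add up. The adjusted measurement weights
pattern p by its inner product with g; if all pattern counts are close to a common N, the weighted
shifts combine, by isotropy (`sum_rowInner_smul_vec`), to a multiple of g, that is, to a shift of x
by a constant s (`shiftSize`).

Hence the correlation of the answer with the adjusted measurement at value x is about (N/2ℓ)(φ(x) -
φ(x - s)), with φ the mean answer. Averaging over the uniform x telescopes to two windows of length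
s at the ends of the range, where correctness makes φ close to 1 and to -1 on average over runs. So
each query contributes about `drift` to the mean of X, whatever the algorithm does between the two
thresholds (`Run.abs_stepMean_sub_contrast_le`, `one_sub_le_integral_contrast`). The errors are o(σ)
because pattern counts concentrate (`expect_imbalance_le`).

For the variance, the contributions minus their conditional means are martingale differences, hence
orthogonal (`integral_noise_mul_noise`). Their uncentered second moments do not see the answers,
since s² = 1 (`integral_step_sq`), and equal those of a fresh sketch. The conditional means stay
near `drift` in L² (`integral_stepMean_sub_sq_le`) and disturb the variance only slightly
(`abs_variance_add_sub_le`). -/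

lemma expect_add_fun {α : Type*} [Fintype α] (f g : α → ℝ) :
    (𝔼 x, (f x + g x)) = (𝔼 x, f x) + 𝔼 x, g x :=
  Finset.expect_add_distrib _ _ _

lemma expect_sq_le {α : Type*} [Fintype α] [Nonempty α] (f : α → ℝ) :
    (𝔼 x, |f x|) ^ 2 ≤ 𝔼 x, f x ^ 2 := by
  have := Finset.expect_mul_sq_le_sq_mul_sq Finset.univ (fun x => |f x|) (fun _ => (1 : ℝ))
  simpa using this

/-- Resampling one coordinate does not change a uniform average. -/
lemma expect_update (i : ι) (F : (ι → π) → ℝ) :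
    (𝔼 W, 𝔼 p, F (Function.update W i p)) = 𝔼 W, F W := by
  rcases isEmpty_or_nonempty π with hπ | hπ
  · have : IsEmpty (ι → π) := ⟨fun W => hπ.elim (W i)⟩
    rw [Finset.univ_eq_empty, Finset.expect_empty, Finset.expect_empty]
  have h2 : (𝔼 x : (ι → π) × π, F x.1) = 𝔼 W, F W := by
    rw [← Finset.univ_product_univ, Finset.expect_product]
    simp
  rw [← h2, ← Finset.univ_product_univ, ← Finset.expect_product' Finset.univ Finset.univ
    (fun (W : ι → π) (p : π) => F (Function.update W i p)), Finset.univ_product_univ]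
  -- Exchanging the coordinate `W i` with the fresh value is an involution of the pairs.
  refine Fintype.expect_equiv (Function.Involutive.toPerm
    (fun x : (ι → π) × π => (Function.update x.1 i x.2, x.1 i)) ?_) _ _ (fun x => ?_)
  · intro x
    simp
  · rfl

lemma expect_eq_zero_of_update (i : ι) (F : (ι → π) → ℝ)
    (h : ∀ W, (𝔼 p, F (Function.update W i p)) = 0) : (𝔼 W, F W) = 0 := by
  rw [← expect_update i F]
  simp [h]

/-- The second moment of a sum of functions each of which is centered in its own coordinate and
does not depend on the coordinates of the others. -/
lemma expect_sum_sq (S : Finset ι) (x : ι → (ι → π) → ℝ)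
    (h0 : ∀ i ∈ S, ∀ W, (𝔼 p, x i (Function.update W i p)) = 0)
    (h1 : ∀ i ∈ S, ∀ i' ∈ S, i ≠ i' → ∀ W p, x i' (Function.update W i p) = x i' W) :
    (𝔼 W, (∑ i ∈ S, x i W) ^ 2) = ∑ i ∈ S, 𝔼 W, x i W ^ 2 := by
  simp_rw [sq, Finset.sum_mul_sum]
  rw [Finset.expect_sum_comm]
  refine Finset.sum_congr rfl fun i hi => ?_
  rw [Finset.expect_sum_comm, Finset.sum_eq_single_of_mem i hi]
  intro i' hi' hne
  refine expect_eq_zero_of_update i _ fun W => ?_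
  simp_rw [h1 i hi i' hi' hne.symm, ← Finset.expect_mul, h0 i hi, zero_mul]

end FiniteAverages

/-! ### Rademacher sums -/

lemma sgn_mul_self (s : Bool) : sgn s * sgn s = 1 := by cases s <;> simp [sgn]

lemma sgn_sq (s : Bool) : sgn s ^ 2 = 1 := by cases s <;> simp [sgn]

lemma abs_sgn (s : Bool) : |sgn s| = 1 := by cases s <;> simp [sgn]

lemma sgn_not (s : Bool) : sgn (!s) = -sgn s := by cases s <;> simp [sgn]

lemma expect_sgn : (𝔼 s, sgn s) = 0 := by
  rw [Fintype.expect_eq_sum_div_card]; simp [sgn]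

section Rademacher

variable {ι : Type*} [DecidableEq ι]

/-- Negate the sign of one coordinate. -/
def flipAt (i : ι) (z : ι → Bool) : ι → Bool := Function.update z i (!z i)

lemma flipAt_involutive (i : ι) : Function.Involutive (flipAt i) := by
  intro z; simp [flipAt]

lemma sgn_flipAt_self (i : ι) (z : ι → Bool) : sgn (flipAt i z i) = -sgn (z i) := by
  simp [flipAt, sgn_not]

lemma flipAt_of_ne {i i' : ι} (h : i' ≠ i) (z : ι → Bool) : flipAt i z i' = z i' := by
  simp [flipAt, h]

lemma expect_flipAt [Fintype ι] (i : ι) (F : (ι → Bool) → ℝ) :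
    (𝔼 z, F (flipAt i z)) = 𝔼 z, F z :=
  Fintype.expect_equiv (flipAt_involutive i).toPerm _ _ fun _ => rfl

variable {V : Type*} [AddCommGroup V] [Module ℝ V]

/-- The signed sum of the vectors `w i`, `i ∈ S`. -/
def signedSum (S : Finset ι) (w : ι → V) (z : ι → Bool) : V := ∑ i ∈ S, sgn (z i) • w i

lemma signedSum_flipAt (S : Finset ι) (w : ι → V) {i : ι} (hi : i ∈ S) (z : ι → Bool) :
    signedSum S w (flipAt i z) = signedSum S w z - (2 * sgn (z i)) • w i := by
  have h : signedSum S w (flipAt i z) - signedSum S w z = -((2 * sgn (z i)) • w i) := by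
    rw [signedSum, signedSum, ← Finset.sum_sub_distrib, Finset.sum_eq_single_of_mem i hi]
    · rw [sgn_flipAt_self]; module
    · intro i' _ hne
      rw [flipAt_of_ne hne, sub_self]
  rw [sub_eq_add_neg, ← h]; abel

variable [Fintype ι]

lemma expect_signedSum_sq (S : Finset ι) (a : ι → ℝ) :
    (𝔼 z, signedSum S a z ^ 2) = ∑ i ∈ S, a i ^ 2 := by
  unfold signedSum
  rw [expect_sum_sq S (fun i z => sgn (z i) • a i)]
  · simp [mul_pow, sgn_sq]
  · intro i _ W
    simp only [Function.update_self, smul_eq_mul]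
    rw [← Finset.expect_mul, expect_sgn, zero_mul]
  · intro i _ i' _ hne W p
    simp [Function.update_of_ne hne.symm]

lemma expect_abs_signedSum_sq_le (S : Finset ι) (a : ι → ℝ) :
    (𝔼 z, |signedSum S a z|) ^ 2 ≤ ∑ i ∈ S, a i ^ 2 :=
  (expect_sq_le _).trans (expect_signedSum_sq S a).le

/-- The average of `f (y + ∑ ± w i)`. -/
def smoothed (S : Finset ι) (w : ι → V) (f : V → ℝ) (y : V) : ℝ :=
  𝔼 z, f (y + signedSum S w z)

/-- The average of `f (y + ∑ ± w i)`, weighted by the sum of the signs in `C`. -/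
def weighted (S : Finset ι) (w : ι → V) (f : V → ℝ) (C : Finset ι) (y : V) : ℝ :=
  𝔼 z, signedSum C (fun _ => (1 : ℝ)) z * f (y + signedSum S w z)

/-- After flipping coordinate `i`, the weight `1 + sgn (z i)` is nonzero only for a positive sign,
and exactly there the flip subtracts 2p from the signed sum. The factor `A` is free so that one
identity serves both first-order (`A = 1`) and second-order differences. -/
lemma sum_expect_flip (S C : Finset ι) (hC : C ⊆ S) (w : ι → V) (p : V) (hp : ∀ i ∈ C, w i = p)
    (f : V → ℝ) (A : (ι → Bool) → ℝ) (y : V) :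
    (∑ i ∈ C, 𝔼 z, (1 - sgn (z i)) * A z * f (y + signedSum S w z)) =
      ∑ i ∈ C, 𝔼 z, (1 + sgn (z i)) * A (flipAt i z) *
        f (y - (2 : ℝ) • p + signedSum S w z) := by
  refine Finset.sum_congr rfl fun i hi => ?_
  rw [← expect_flipAt i]
  refine Finset.expect_congr rfl fun z _ => ?_
  rw [sgn_flipAt_self, signedSum_flipAt S w (hC hi), hp i hi]
  cases hz : z i
  · simp [sgn]
  · have : y + (signedSum S w z - (2 * sgn true) • p) = y - (2 : ℝ) • p + signedSum S w z := by
      simp only [sgn, if_true, mul_one]; abel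
    rw [this]; ring_nf

omit [DecidableEq ι] [Fintype ι] in
lemma signedSum_one (C : Finset ι) (z : ι → Bool) :
    signedSum C (fun _ => (1 : ℝ)) z = ∑ i ∈ C, sgn (z i) := by
  simp [signedSum]

/-- The flip identity with `A = 1`: the constant parts of the weights 1 ∓ sgn give `smoothed`, the
sign parts give `weighted`. -/
lemma card_mul_smoothed_sub (S C : Finset ι) (hC : C ⊆ S) (w : ι → V) (p : V)
    (hp : ∀ i ∈ C, w i = p) (f : V → ℝ) (y : V) :
    (C.card : ℝ) * (smoothed S w f y - smoothed S w f (y - (2 : ℝ) • p)) =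
      weighted S w f C y + weighted S w f C (y - (2 : ℝ) • p) := by
  have h := sum_expect_flip S C hC w p hp f (fun _ => 1) y
  have e1 : ∀ y, (∑ i ∈ C, 𝔼 z, (1 - sgn (z i)) * 1 * f (y + signedSum S w z)) =
      C.card * smoothed S w f y - weighted S w f C y := by
    intro y
    rw [← Finset.expect_sum_comm, smoothed, weighted, Finset.mul_expect,
      ← Finset.expect_sub_distrib]
    refine Finset.expect_congr rfl fun z _ => ?_
    rw [← Finset.sum_mul, ← Finset.sum_mul, Finset.sum_sub_distrib, signedSum_one]
    simp; ring
  have e2 : ∀ y, (∑ i ∈ C, 𝔼 z, (1 + sgn (z i)) * 1 * f (y + signedSum S w z)) =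
      C.card * smoothed S w f y + weighted S w f C y := by
    intro y
    rw [← Finset.expect_sum_comm, smoothed, weighted, Finset.mul_expect,
      ← Finset.expect_add_distrib]
    refine Finset.expect_congr rfl fun z _ => ?_
    rw [← Finset.sum_mul, ← Finset.sum_mul, Finset.sum_add_distrib, signedSum_one]
    simp; ring
  rw [e1, e2] at h
  linarith

lemma abs_expect_mul_le {α : Type*} [Fintype α] (A g : α → ℝ) (hg : ∀ x, |g x| ≤ 1) :
    |𝔼 x, A x * g x| ≤ 𝔼 x, |A x| := by
  refine (Finset.abs_expect_le _ _).trans (Finset.expect_le_expect fun x _ => ?_)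
  rw [abs_mul]
  exact mul_le_of_le_one_right (abs_nonneg _) (hg x)

lemma abs_weighted_le (S : Finset ι) (w : ι → V) (f : V → ℝ) (hf : ∀ y, |f y| ≤ 1)
    (C : Finset ι) (y : V) : |weighted S w f C y| ≤ √(C.card : ℝ) := by
  refine (abs_expect_mul_le _ _ fun z => hf _).trans ?_
  refine Real.le_sqrt_of_sq_le ?_
  simpa using expect_abs_signedSum_sq_le C (fun _ => (1 : ℝ))

/-- The flip identity with `A` the sign sum R' over `C'`. Besides the wanted difference it leaves
two averages of R·R'·f, each at most (|C| + |C'|)/2, and the change of R' under the flips, at most 2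
for each key of `C`. For comparable counts, correlations that may be as large as √|C'| thus vary
only by a constant. -/
lemma card_mul_abs_weighted_sub_le (S C C' : Finset ι) (hC : C ⊆ S) (w : ι → V) (p : V)
    (hp : ∀ i ∈ C, w i = p) (f : V → ℝ) (hf : ∀ y, |f y| ≤ 1) (y : V) :
    (C.card : ℝ) * |weighted S w f C' y - weighted S w f C' (y - (2 : ℝ) • p)| ≤
      3 * C.card + C'.card := by
  set R := fun z : ι → Bool => signedSum C (fun _ => (1 : ℝ)) z with hR
  set R' := fun z : ι → Bool => signedSum C' (fun _ => (1 : ℝ)) z with hR'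
  have hRs : ∀ z, R z = ∑ i ∈ C, sgn (z i) := signedSum_one C
  set y' := y - (2 : ℝ) • p with hy'
  have h := sum_expect_flip S C hC w p hp f R' y
  have e1 : (∑ i ∈ C, 𝔼 z, (1 - sgn (z i)) * R' z * f (y + signedSum S w z)) =
      C.card * weighted S w f C' y - 𝔼 z, R z * R' z * f (y + signedSum S w z) := by
    rw [← Finset.expect_sum_comm, weighted, Finset.mul_expect, ← Finset.expect_sub_distrib]
    refine Finset.expect_congr rfl fun z _ => ?_
    rw [← Finset.sum_mul, ← Finset.sum_mul, Finset.sum_sub_distrib, hRs, Finset.sum_const,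
      nsmul_one]
    ring
  have e2 : (∑ i ∈ C, 𝔼 z, (1 + sgn (z i)) * R' (flipAt i z) * f (y' + signedSum S w z)) =
      C.card * weighted S w f C' y' + (𝔼 z, R z * R' z * f (y' + signedSum S w z)) +
      ∑ i ∈ C, 𝔼 z, ((1 + sgn (z i)) * (R' (flipAt i z) - R' z)) * f (y' + signedSum S w z) := by
    rw [← Finset.expect_sum_comm, weighted, Finset.mul_expect, ← Finset.expect_add_distrib,
      ← Finset.expect_sum_comm, ← Finset.expect_add_distrib]
    refine Finset.expect_congr rfl fun z _ => ?_
    have : (C.card : ℝ) * (R' z * f (y' + signedSum S w z)) + R z * R' z *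
        f (y' + signedSum S w z) =
        ∑ i ∈ C, (1 + sgn (z i)) * R' z * f (y' + signedSum S w z) := by
      rw [← Finset.sum_mul, ← Finset.sum_mul, Finset.sum_add_distrib, hRs, Finset.sum_const,
        nsmul_one]
      ring
    rw [show signedSum C' (fun _ => (1 : ℝ)) z = R' z from rfl, this, ← Finset.sum_add_distrib]
    refine Finset.sum_congr rfl fun i _ => ?_
    ring
  have bRR : ∀ y, |𝔼 z, R z * R' z * f (y + signedSum S w z)| ≤ (C.card + C'.card) / 2 := by
    intro y
    refine (abs_expect_mul_le _ _ fun z => hf _).trans ?_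
    have : (𝔼 z, |R z * R' z|) ≤ 𝔼 z, (1 / 2 * R z ^ 2 + 1 / 2 * R' z ^ 2) := by
      refine Finset.expect_le_expect fun z _ => ?_
      rw [abs_mul]
      nlinarith [sq_nonneg (|R z| - |R' z|), sq_abs (R z), sq_abs (R' z)]
    refine this.trans ?_
    rw [expect_add_fun, ← Finset.mul_expect, ← Finset.mul_expect, hR, hR', expect_signedSum_sq,
      expect_signedSum_sq]
    simp; linarith
  have bE : |∑ i ∈ C, 𝔼 z, ((1 + sgn (z i)) * (R' (flipAt i z) - R' z)) *
      f (y' + signedSum S w z)| ≤ 2 * C.card := by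
    refine (Finset.abs_sum_le_sum_abs _ _).trans ?_
    have : ∀ i ∈ C, |𝔼 z, ((1 + sgn (z i)) * (R' (flipAt i z) - R' z)) *
      f (y' + signedSum S w z)| ≤ 2 := by
      intro i _
      refine (abs_expect_mul_le _ _ fun z => hf _).trans ?_
      -- A flip changes R' by at most 2, and the nonnegative weight 1 + sgn has mean 1.
      have h2 : (𝔼 z : ι → Bool, |(1 + sgn (z i)) * (R' (flipAt i z) - R' z)|) ≤
          𝔼 z : ι → Bool, (1 + sgn (z i)) * 2 := by
        refine Finset.expect_le_expect fun z _ => ?_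
        have h0 : 0 ≤ 1 + sgn (z i) := by
          have := abs_le.1 (abs_sgn (z i)).le; linarith [this.1]
        rw [abs_mul, abs_of_nonneg h0]
        refine mul_le_mul_of_nonneg_left ?_ h0
        by_cases hi : i ∈ C'
        · simp only [hR', signedSum_flipAt C' _ hi]
          simp [abs_mul, abs_sgn]
        · have : R' (flipAt i z) = R' z := by
            simp only [hR', signedSum]
            refine Finset.sum_congr rfl fun i' hi' => ?_
            rw [flipAt_of_ne (by rintro rfl; exact hi hi')]
          simp [this]
      refine h2.trans ?_
      rw [← Finset.expect_mul, expect_add_fun]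
      have : (𝔼 z : ι → Bool, sgn (z i)) = 0 := by
        refine expect_eq_zero_of_update i _ fun W => ?_
        simpa using expect_sgn
      rw [this]
      simp
    simpa [mul_comm] using Finset.sum_le_sum this
  rw [e1, e2] at h
  rw [← Nat.abs_cast C.card, ← abs_mul, Nat.abs_cast]
  have h3 := bRR y
  have h4 := bRR y'
  rw [abs_le] at *
  constructor <;> linarith [h3.1, h3.2, h4.1, h4.2, bE.1, bE.2]

end Rademacher

/-! ### Adding up shifts by several patterns. -/

section Telescope

variable {ι : Type*} [DecidableEq ι] [Fintype ι] {V : Type*} [AddCommGroup V] [Module ℝ V]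

lemma abs_weighted_sub_le_six (S C C' : Finset ι) (hC : C ⊆ S) (w : ι → V) (p : V)
    (hp : ∀ i ∈ C, w i = p) (f : V → ℝ) (hf : ∀ y, |f y| ≤ 1) (hpos : 0 < (C.card : ℝ))
    (hCC' : (C'.card : ℝ) ≤ 3 * C.card) (τ : ℝ) (hτ : τ = -1 ∨ τ = 0 ∨ τ = 1) (y : V) :
    |weighted S w f C' y - weighted S w f C' (y - (2 * τ) • p)| ≤ 6 := by
  have key : ∀ y, |weighted S w f C' y - weighted S w f C' (y - (2 : ℝ) • p)| ≤ 6 := by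
    intro y
    have := card_mul_abs_weighted_sub_le S C C' hC w p hp f hf y
    have h2 : (C.card : ℝ) * |weighted S w f C' y - weighted S w f C' (y - (2 : ℝ) • p)| ≤
        C.card * 6 := by linarith
    exact le_of_mul_le_mul_left h2 hpos
  rcases hτ with rfl | rfl | rfl
  -- For τ = -1 the estimate is used from the other endpoint, y + 2p.
  · have := key (y - (2 * (-1 : ℝ)) • p)
    rw [show y - (2 * (-1 : ℝ)) • p - (2 : ℝ) • p = y by module] at this
    rwa [abs_sub_comm]
  · simp
  · simpa using key y

/-- Two replacements in `card_mul_smoothed_sub`. Both weighted averages are taken at y, which costs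
6 by the Lipschitz bound. The count c is replaced by N: the difference of the `smoothed` values is
at most 2/√c ≤ 3/√N, so this costs at most ηN · 3/√N = 3η√N. -/
lemma abs_smoothed_sub_le (S C : Finset ι) (hC : C ⊆ S) (w : ι → V) (p : V)
    (hp : ∀ i ∈ C, w i = p) (f : V → ℝ) (hf : ∀ y, |f y| ≤ 1) (N η : ℝ) (hN : 0 < N)
    (hη0 : 0 ≤ η) (hη : η ≤ 1 / 2) (hCN : |(C.card : ℝ) - N| ≤ η * N)
    (τ : ℝ) (hτ : τ = -1 ∨ τ = 0 ∨ τ = 1) (y : V) :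
    |N * (smoothed S w f y - smoothed S w f (y - (2 * τ) • p)) - 2 * (τ * weighted S w f C y)| ≤
      6 + 3 * η * √N := by
  set c : ℝ := (C.card : ℝ) with hc
  have hcN : N / 2 ≤ c := by
    have := (abs_le.1 hCN).1
    nlinarith
  have hcpos : 0 < c := by linarith
  have hlip := fun y => abs_weighted_sub_le_six S C C hC w p hp f hf hcpos
    (by linarith : c ≤ 3 * c) 1 (by simp) y
  have hs : √c * √c = c := Real.mul_self_sqrt hcpos.le
  have hsN : √N * √N = N := Real.mul_self_sqrt hN.le
  have hsc : 0 < √c := Real.sqrt_pos.2 hcpos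
  have hsNc : √N ≤ 3 / 2 * √c := by
    refine (sq_le_sq₀ (Real.sqrt_nonneg _) (by positivity)).1 ?_
    rw [Real.sq_sqrt hN.le, mul_pow, Real.sq_sqrt hcpos.le]; linarith
  have key : ∀ y, |N * (smoothed S w f y - smoothed S w f (y - (2 : ℝ) • p)) -
      (weighted S w f C y + weighted S w f C (y - (2 : ℝ) • p))| ≤ 3 * η * √N := by
    intro y
    have h := card_mul_smoothed_sub S C hC w p hp f y
    rw [← hc] at h
    set Δ := smoothed S w f y - smoothed S w f (y - (2 : ℝ) • p)
    have h1 : c * |Δ| ≤ 2 * √c := by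
      rw [← abs_of_pos hcpos, ← abs_mul, abs_of_pos hcpos, h]
      refine (abs_add_le _ _).trans ?_
      have := abs_weighted_le S w f hf C y
      have := abs_weighted_le S w f hf C (y - (2 : ℝ) • p)
      linarith
    have h2 : √c * |Δ| ≤ 2 := by
      refine le_of_mul_le_mul_left ?_ hsc
      rw [← mul_assoc, hs]; linarith
    have h3 : √N * |Δ| ≤ 3 := by
      calc √N * |Δ| ≤ 3 / 2 * √c * |Δ| := mul_le_mul_of_nonneg_right hsNc (abs_nonneg _)
        _ ≤ 3 := by linarith
    rw [← h, ← sub_mul, abs_mul, abs_sub_comm]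
    calc |c - N| * |Δ| ≤ η * N * |Δ| := mul_le_mul_of_nonneg_right hCN (abs_nonneg _)
      _ = η * √N * (√N * |Δ|) := by nth_rewrite 1 [← hsN]; ring
      _ ≤ η * √N * 3 := mul_le_mul_of_nonneg_left h3 (by positivity)
      _ = _ := by ring
  rcases hτ with rfl | rfl | rfl
  · have h1 := key (y - (2 * (-1 : ℝ)) • p)
    have h2 := hlip (y - (2 * (-1 : ℝ)) • p)
    rw [show y - (2 * (-1 : ℝ)) • p - (2 : ℝ) • p = y by module] at h1
    rw [show y - (2 * (-1 : ℝ)) • p - (2 * (1 : ℝ)) • p = y by module] at h2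
    rw [abs_le] at *
    constructor <;> linarith [h1.1, h1.2, h2.1, h2.2]
  · simp; positivity
  · have h1 := key y
    have h2 := hlip y
    rw [mul_one] at *
    rw [abs_le] at *
    constructor <;> linarith [h1.1, h1.2, h2.1, h2.2]

/-- Shifting the argument of `smoothed S w f` by a sum of few of the vectors changes it by the
corresponding combination of weighted averages, up to a bounded error. -/
lemma abs_smoothed_sub_sum_le {J : Type*} [DecidableEq J] (S : Finset ι) (C : J → Finset ι)
    (hC : ∀ a, C a ⊆ S) (w : ι → V) (p : J → V) (hp : ∀ a, ∀ i ∈ C a, w i = p a) (f : V → ℝ)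
    (hf : ∀ y, |f y| ≤ 1) (N η : ℝ) (hN : 0 < N) (hη0 : 0 ≤ η) (hη : η ≤ 1 / 2)
    (hCN : ∀ a, |((C a).card : ℝ) - N| ≤ η * N) (τ : J → ℝ)
    (hτ : ∀ a, τ a = -1 ∨ τ a = 0 ∨ τ a = 1) (y : V) (T : Finset J) :
    |N * (smoothed S w f y - smoothed S w f (y - ∑ a ∈ T, (2 * τ a) • p a)) -
        2 * ∑ a ∈ T, τ a * weighted S w f (C a) y| ≤
      T.card * (6 + 3 * η * √N + 12 * T.card) := by
  have hlo : ∀ a, N / 2 ≤ ((C a).card : ℝ) := fun a => by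
    have := (abs_le.1 (hCN a)).1
    nlinarith
  have hhi : ∀ a, ((C a).card : ℝ) ≤ 3 / 2 * N := fun a => by
    have := (abs_le.1 (hCN a)).2
    nlinarith
  have hlip : ∀ T : Finset J, ∀ a, |weighted S w f (C a) y -
      weighted S w f (C a) (y - ∑ a ∈ T, (2 * τ a) • p a)| ≤ 6 * T.card := by
    intro T a
    induction T using Finset.induction_on with
    | empty => simp
    | insert b T hb ih =>
      rw [Finset.sum_insert hb, Finset.card_insert_of_notMem hb]
      have := abs_weighted_sub_le_six S (C b) (C a) (hC b) w (p b) (hp b) f hf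
        (by linarith [hlo b]) (by linarith [hlo b, hhi a]) (τ b) (hτ b)
        (y - ∑ a ∈ T, (2 * τ a) • p a)
      rw [sub_sub, add_comm (∑ a ∈ T, _)] at this
      push_cast
      rw [abs_le] at *
      constructor <;> linarith [ih.1, ih.2, this.1, this.2]
  induction T using Finset.induction_on with
  | empty => simp
  -- The new shift is estimated at the already shifted point. Moving its weighted average back to y
  -- costs 6 for each earlier shift, doubled by the factor 2; this is the source of 12 |T|.
  | insert b T hb ih =>
    rw [Finset.sum_insert hb, Finset.card_insert_of_notMem hb, Finset.sum_insert hb]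
    have h1 := abs_smoothed_sub_le S (C b) (hC b) w (p b) (hp b) f hf N η hN hη0 hη (hCN b)
      (τ b) (hτ b) (y - ∑ a ∈ T, (2 * τ a) • p a)
    have h2 := hlip T b
    have h3 : |τ b * weighted S w f (C b) y - τ b *
      weighted S w f (C b) (y - ∑ a ∈ T, (2 * τ a) • p a)| ≤ 6 * T.card := by
      rw [← mul_sub, abs_mul]
      have : |τ b| ≤ 1 := by rcases hτ b with h | h | h <;> simp [h]
      exact (mul_le_of_le_one_left (abs_nonneg _) this).trans h2
    rw [sub_sub, add_comm (∑ a ∈ T, _)] at h1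
    push_cast
    have h4 : (T.card : ℝ) * (6 + 3 * η * √N + 12 * T.card) + (6 + 3 * η * √N + 12 * T.card) ≤
        ((T.card : ℝ) + 1) * (6 + 3 * η * √N + 12 * (T.card + 1)) := by
      have : (0 : ℝ) ≤ T.card := Nat.cast_nonneg _
      nlinarith
    refine le_trans ?_ h4
    rw [abs_le] at *
    constructor <;> linarith [ih.1, ih.2, h1.1, h1.2, h3.1, h3.2]

end Telescope

/-! ### Patterns: the randomness attached to one key -/

/-- The bucket and the sign of a key in every row. -/
abbrev Pattern (ℓ b : ℕ) : Type := Fin ℓ → Fin b × Bool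

/-- The measurements of a unit vector of a key with the given pattern. -/
def Pattern.vec {ℓ b : ℕ} (p : Pattern ℓ b) : Fin ℓ → Fin b → ℝ :=
  fun j k => if (p j).1 = k then sgn (p j).2 else 0

/-- The contribution of row `j` to the inner product of two patterns. -/
def Pattern.rowInner {ℓ b : ℕ} (g p : Pattern ℓ b) (j : Fin ℓ) : ℝ :=
  if (p j).1 = (g j).1 then sgn (p j).2 * sgn (g j).2 else 0

/-- The inner product of the measurement vectors of two patterns. -/
def Pattern.inner {ℓ b : ℕ} (g p : Pattern ℓ b) : ℝ := ∑ j, g.rowInner p j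

/-- The pattern of a key. -/
def patternOf {n ℓ b : ℕ} (ρ : Randomness n ℓ b) (i : Fin n) : Pattern ℓ b :=
  fun j => ((ρ j).1 i, (ρ j).2 i)

section Patterns

variable {n ℓ b : ℕ}

lemma Pattern.rowInner_cases (g p : Pattern ℓ b) (j : Fin ℓ) :
    g.rowInner p j = -1 ∨ g.rowInner p j = 0 ∨ g.rowInner p j = 1 := by
  unfold Pattern.rowInner
  split_ifs
  · cases (p j).2 <;> cases (g j).2 <;> simp [sgn]
  · simp

lemma Pattern.abs_inner_le (g p : Pattern ℓ b) : |g.inner p| ≤ ℓ := by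
  refine (Finset.abs_sum_le_sum_abs _ _).trans ?_
  have : ∀ j ∈ Finset.univ, |g.rowInner p j| ≤ 1 := fun j _ => by
    rcases g.rowInner_cases p j with h | h | h <;> simp [h]
  simpa using Finset.sum_le_sum this

lemma Pattern.rowInner_eq (g p : Pattern ℓ b) (j : Fin ℓ) :
    g.rowInner p j = p.vec j (g j).1 * sgn (g j).2 := by
  simp [Pattern.rowInner, Pattern.vec]

lemma measVec_eq (ρ : Randomness n ℓ b) (j : Fin ℓ) (k : Fin b) (i : Fin n) :
    measVec ρ j k i = (patternOf ρ i).vec j k := by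
  rfl

lemma sketch_eq (ρ : Randomness n ℓ b) (v : Fin n → ℝ) :
    sketch ρ v = ∑ i, v i • (patternOf ρ i).vec := by
  ext j k
  simp [sketch, dotProduct, measVec_eq, Finset.sum_apply, mul_comm]

lemma avgAdjusted_eq (ρ : Randomness n ℓ b) (i : Fin n) (v : Fin n → ℝ) :
    avgAdjusted ρ i v = (1 / (ℓ : ℝ)) * ∑ i', v i' * (patternOf ρ i).inner (patternOf ρ i') := by
  unfold avgAdjusted
  congr 1
  simp_rw [Pattern.inner, Pattern.rowInner_eq, Finset.mul_sum]
  rw [Finset.sum_comm]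
  refine Finset.sum_congr rfl fun j _ => ?_
  rw [sketch_eq, Finset.sum_apply, Finset.sum_apply, Finset.sum_mul]
  refine Finset.sum_congr rfl fun i' _ => ?_
  simp [measVec, patternOf]
  ring

variable [NeZero b]

omit [NeZero b] in
lemma expect_ite_bucket (k : Fin b) : (𝔼 k' : Fin b, if k' = k then (1 : ℝ) else 0) = 1 / b := by
  rw [Fintype.expect_eq_sum_div_card]; simp

/-- The pattern of a uniformly random key is isotropic. -/
lemma expect_rowInner_mul_vec (g : Pattern ℓ b) (j j' : Fin ℓ) (k : Fin b) :
    (𝔼 p : Pattern ℓ b, g.rowInner p j * p.vec j' k) =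
      if j = j' then g.vec j k / b else 0 := by
  have hs : ∀ (F : Fin b → ℝ), (𝔼 q : Fin b × Bool, F q.1 * sgn q.2) = 0 := by
    intro F
    rw [← Finset.univ_product_univ, Finset.expect_product]
    refine Finset.expect_eq_zero fun k _ => ?_
    change (𝔼 s : Bool, F k * sgn s) = 0
    rw [← Finset.mul_expect, expect_sgn, mul_zero]
  split_ifs with h
  · subst h
    rw [← expect_update j]
    have : ∀ p : Pattern ℓ b, (𝔼 q : Fin b × Bool, g.rowInner (Function.update p j q) j *
        Pattern.vec (Function.update p j q) j k) = g.vec j k / b := by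
      intro p
      rw [← Finset.univ_product_univ, Finset.expect_product]
      have : ∀ k' : Fin b, ∀ s : Bool, g.rowInner (Function.update p j (k', s)) j *
        Pattern.vec (Function.update p j (k', s)) j k =
          (if k' = (g j).1 then (1 : ℝ) else 0) * g.vec j k := by
        intro k' s
        simp only [Pattern.rowInner, Pattern.vec, Function.update_self]
        by_cases h1 : k' = (g j).1
        · subst h1
          by_cases h2 : (g j).1 = k
          · simp only [h2, if_true]; linear_combination sgn (g j).2 * sgn_mul_self s
          · simp [h2]
        · simp [h1]
      simp_rw [this]
      simp only [Fintype.expect_const]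
      rw [← Finset.expect_mul, expect_ite_bucket]; ring
    simp [this]
  -- For distinct rows, the sign in row `j` is independent of row `j'` and centered.
  · refine expect_eq_zero_of_update j _ fun p => ?_
    have : ∀ q : Fin b × Bool, g.rowInner (Function.update p j q) j *
        Pattern.vec (Function.update p j q) j' k =
        ((if q.1 = (g j).1 then sgn (g j).2 else 0) * Pattern.vec p j' k) * sgn q.2 := by
      intro q
      simp only [Pattern.rowInner, Pattern.vec, Function.update_self,
        Function.update_of_ne (Ne.symm h)]
      split_ifs <;> ring
    simp_rw [this]
    exact hs fun k' => (if k' = (g j).1 then sgn (g j).2 else 0) * Pattern.vec p j' k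

omit [NeZero b] in
lemma expect_inner (g : Pattern ℓ b) : (𝔼 p : Pattern ℓ b, g.inner p) = 0 := by
  unfold Pattern.inner
  rw [Finset.expect_sum_comm]
  refine Finset.sum_eq_zero fun j _ => expect_eq_zero_of_update j _ fun p => ?_
  rw [← Finset.univ_product_univ, Finset.expect_product]
  refine Finset.expect_eq_zero fun k _ => ?_
  have : ∀ s : Bool, g.rowInner (Function.update p j (k, s)) j =
      (if k = (g j).1 then sgn (g j).2 else 0) * sgn s := by
    intro s
    simp only [Pattern.rowInner, Function.update_self]
    split_ifs <;> ring
  simp_rw [this]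
  rw [← Finset.mul_expect, expect_sgn, mul_zero]

lemma expect_inner_sq (g : Pattern ℓ b) : (𝔼 p : Pattern ℓ b, g.inner p ^ 2) = ℓ / b := by
  unfold Pattern.inner
  simp_rw [sq, Finset.sum_mul_sum]
  rw [Finset.expect_sum_comm]
  have : ∀ j : Fin ℓ, (𝔼 p : Pattern ℓ b, ∑ j', g.rowInner p j * g.rowInner p j') = 1 / b := by
    intro j
    rw [Finset.expect_sum_comm]
    have : ∀ j', (𝔼 p : Pattern ℓ b, g.rowInner p j * g.rowInner p j') =
        if j = j' then (1 / b : ℝ) else 0 := by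
      intro j'
      simp_rw [g.rowInner_eq _ j', ← mul_assoc]
      rw [← Finset.expect_mul, expect_rowInner_mul_vec]
      split_ifs with h
      · subst h
        simp [Pattern.vec, div_mul_eq_mul_div, sgn_mul_self]
      · simp
    simp [this]
  simp_rw [this]
  simp; ring

/-- The sum of all patterns, weighted by a row of the inner product with `g`. -/
lemma sum_rowInner_smul_vec (g : Pattern ℓ b) :
    (∑ a : Fin ℓ × Pattern ℓ b, (2 * g.rowInner a.2 a.1) • a.2.vec) =
      (2 * Fintype.card (Pattern ℓ b) / b : ℝ) • g.vec := by
  ext j' k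
  simp only [Finset.sum_apply, Pi.smul_apply, smul_eq_mul]
  rw [← Finset.univ_product_univ, Finset.sum_product]
  have : ∀ j, (∑ p : Pattern ℓ b, 2 * g.rowInner p j * p.vec j' k) =
      2 * (Fintype.card (Pattern ℓ b) * if j = j' then g.vec j k / b else 0) := by
    intro j
    rw [← expect_rowInner_mul_vec, Fintype.card_mul_expect, Finset.mul_sum]
    exact Finset.sum_congr rfl fun p _ => by ring
  simp_rw [this]
  simp; ring

end Patterns

lemma integral_uniformOn_univ {α : Type*} [Fintype α] [Nonempty α] [MeasurableSpace α]
    [MeasurableSingletonClass α] (F : α → ℝ) :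
    ∫ x, F x ∂(uniformOn (Set.univ : Set α)) = 𝔼 x, F x := by
  have := isProbabilityMeasure_uniformOn (Set.finite_univ (α := α)) Set.univ_nonempty
  rw [integral_fintype Integrable.of_finite, Fintype.expect_eq_sum_div_card, Finset.sum_div]
  refine Finset.sum_congr rfl fun x _ => ?_
  rw [measureReal_def, uniformOn_univ]
  simp [div_eq_inv_mul]

/-! ### Moments of adjusted measurements and concentration of pattern counts. -/

section SketchMoments

variable {n ℓ b : ℕ}

/-- The sketch randomness as a pattern for every key. -/
def randomnessEquiv (n ℓ b : ℕ) : Randomness n ℓ b ≃ (Fin n → Pattern ℓ b) where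
  toFun := patternOf
  invFun W := fun j => (fun i => (W i j).1, fun i => (W i j).2)
  left_inv _ := rfl
  right_inv _ := rfl

lemma expect_patternOf (F : (Fin n → Pattern ℓ b) → ℝ) :
    (𝔼 ρ : Randomness n ℓ b, F (patternOf ρ)) = 𝔼 W, F W :=
  Fintype.expect_equiv (randomnessEquiv n ℓ b) _ _ fun _ => rfl

lemma avgAdjusted_eq_erase (ρ : Randomness n ℓ b) (i : Fin n) (v : Fin n → ℝ) (hv : v i = 0) :
    avgAdjusted ρ i v = (1 / (ℓ : ℝ)) *
      ∑ i' ∈ Finset.univ.erase i, v i' * (patternOf ρ i).inner (patternOf ρ i') := by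
  rw [avgAdjusted_eq, Finset.sum_erase]
  simp [hv]

lemma expect_inner_update (v : Fin n → ℝ) {i i' : Fin n} (h : i' ≠ i) (W : Fin n → Pattern ℓ b) :
    (𝔼 p, v i' * (Function.update W i' p i).inner (Function.update W i' p i')) = 0 := by
  simp only [Function.update_self, Function.update_of_ne h.symm]
  rw [← Finset.mul_expect, expect_inner, mul_zero]

/-- An adjusted measurement of an independent vector is centered. -/
lemma expect_avgAdjusted (i : Fin n) (v : Fin n → ℝ) (hv : v i = 0) :
    (𝔼 ρ : Randomness n ℓ b, avgAdjusted ρ i v) = 0 := by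
  simp_rw [fun ρ : Randomness n ℓ b => avgAdjusted_eq_erase ρ i v hv]
  rw [expect_patternOf fun W => (1 / (ℓ : ℝ)) *
    ∑ i' ∈ Finset.univ.erase i, v i' * (W i).inner (W i'), ← Finset.mul_expect,
    Finset.expect_sum_comm, Finset.sum_eq_zero, mul_zero]
  intro i' hi'
  exact expect_eq_zero_of_update i' _ (expect_inner_update v (Finset.ne_of_mem_erase hi'))

/-- The second moment of the average adjusted measurement of an independent vector. -/
lemma expect_avgAdjusted_sq [NeZero b] (hℓ : 0 < ℓ) (i : Fin n) (v : Fin n → ℝ) (hv : v i = 0) :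
    (𝔼 ρ : Randomness n ℓ b, avgAdjusted ρ i v ^ 2) = (∑ i', v i' ^ 2) / (ℓ * b) := by
  simp_rw [fun ρ : Randomness n ℓ b => avgAdjusted_eq_erase ρ i v hv, mul_pow]
  rw [expect_patternOf fun W => (1 / (ℓ : ℝ)) ^ 2 *
    (∑ i' ∈ Finset.univ.erase i, v i' * (W i).inner (W i')) ^ 2, ← Finset.mul_expect,
    expect_sum_sq _ fun i' (W : Fin n → Pattern ℓ b) => v i' * (W i).inner (W i')]
  · have : ∀ i' ∈ Finset.univ.erase i, (𝔼 W : Fin n → Pattern ℓ b,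
        (v i' * (W i).inner (W i')) ^ 2) = v i' ^ 2 * (ℓ / b) := by
      intro i' hi'
      rw [← expect_update i']
      have hne := Finset.ne_of_mem_erase hi'
      simp only [Function.update_self, Function.update_of_ne hne.symm, mul_pow]
      simp_rw [← Finset.mul_expect, expect_inner_sq]
      simp
    rw [Finset.sum_congr rfl this, ← Finset.sum_mul, Finset.sum_erase _ (by simp [hv])]
    have : (ℓ : ℝ) ≠ 0 := by positivity
    field_simp
  · exact fun i' hi' W => expect_inner_update v (Finset.ne_of_mem_erase hi') W
  · intro i' hi' i'' hi'' hne W p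
    simp [Function.update_of_ne (Finset.ne_of_mem_erase hi').symm, Function.update_of_ne hne.symm]

/-- The keys in `S` with pattern `p`. -/
def keysWith (ρ : Randomness n ℓ b) (S : Finset (Fin n)) (p : Pattern ℓ b) : Finset (Fin n) :=
  S.filter fun i => patternOf ρ i = p

/-- The squared deviations of the pattern counts from their mean. -/
def imbalance (ρ : Randomness n ℓ b) (S : Finset (Fin n)) : ℝ :=
  ∑ p : Pattern ℓ b, (((keysWith ρ S p).card : ℝ) - S.card / Fintype.card (Pattern ℓ b)) ^ 2

lemma imbalance_nonneg (ρ : Randomness n ℓ b) (S : Finset (Fin n)) : 0 ≤ imbalance ρ S :=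
  Finset.sum_nonneg fun _ _ => sq_nonneg _

/-- Each count is a sum of independent indicators, so its variance is at most |S|; this crude bound
is summed over the patterns. -/
lemma expect_imbalance_le [NeZero b] (S : Finset (Fin n)) :
    (𝔼 ρ : Randomness n ℓ b, imbalance ρ S) ≤ Fintype.card (Pattern ℓ b) * S.card := by
  unfold imbalance
  rw [Finset.expect_sum_comm]
  set P : ℝ := (Fintype.card (Pattern ℓ b) : ℝ) with hP
  have hP1 : 1 ≤ P := by
    rw [hP]; exact_mod_cast Fintype.card_pos
  have : ∀ p ∈ (Finset.univ : Finset (Pattern ℓ b)), (𝔼 ρ : Randomness n ℓ b,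
      (((keysWith ρ S p).card : ℝ) - S.card / P) ^ 2) ≤ S.card := by
    intro p _
    have e : ∀ ρ : Randomness n ℓ b, ((keysWith ρ S p).card : ℝ) - S.card / P =
        ∑ i ∈ S, ((if patternOf ρ i = p then 1 else 0) - 1 / P) := by
      intro ρ
      rw [Finset.sum_sub_distrib, keysWith, Finset.card_filter]
      simp [div_eq_mul_inv]
    simp_rw [e]
    rw [expect_patternOf fun W => (∑ i ∈ S, ((if W i = p then 1 else 0) - 1 / P)) ^ 2,
      expect_sum_sq S fun i (W : Fin n → Pattern ℓ b) => ((if W i = p then (1 : ℝ) else 0) - 1 / P)]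
    · have : ∀ i ∈ S, (𝔼 W : Fin n → Pattern ℓ b,
          ((if W i = p then (1 : ℝ) else 0) - 1 / P) ^ 2) ≤ 1 := by
        intro i _
        refine Finset.expect_le Finset.univ_nonempty fun W _ => ?_
        have h1 : 0 ≤ 1 / P := by positivity
        have h2 : 1 / P ≤ 1 := by rw [div_le_one (by linarith)]; exact hP1
        split_ifs <;> nlinarith
      simpa using Finset.sum_le_sum this
    · intro i _ W
      simp only [Function.update_self]
      rw [Finset.expect_sub_distrib, Fintype.expect_eq_sum_div_card]
      simp [hP]
    · intro i _ i' _ hne W q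
      simp [Function.update_of_ne hne.symm]
  refine (Finset.sum_le_sum this).trans ?_
  rw [Finset.sum_const, Finset.card_univ, nsmul_eq_mul]

end SketchMoments

/-! ### Correlation of the answer with the adjusted measurement in a single query. -/

section SingleQuery

variable {n ℓ b : ℕ}

/-- The vector with the signs `z` on `S`. -/
def signVec (S : Finset (Fin n)) (z : Fin n → Bool) : Fin n → ℝ :=
  fun i => if i ∈ S then sgn (z i) else 0

lemma sum_signVec_smul {V : Type*} [AddCommGroup V] [Module ℝ V] (S : Finset (Fin n))
    (z : Fin n → Bool) (w : Fin n → V) : ∑ i, signVec S z i • w i = signedSum S w z := by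
  simp [signVec, signedSum, ite_smul]

lemma sum_signVec_sq (S : Finset (Fin n)) (z : Fin n → Bool) :
    ∑ i, signVec S z i ^ 2 = S.card := by
  simp [signVec, ite_pow, sgn_sq]

lemma sketch_query (ρ : Randomness n ℓ b) (i : Fin n) (S : Finset (Fin n)) (z : Fin n → Bool)
    (x : ℝ) : sketch ρ (Pi.single i x + signVec S z) =
      x • (patternOf ρ i).vec + signedSum S (fun i => (patternOf ρ i).vec) z := by
  rw [sketch_eq, ← sum_signVec_smul]
  simp [add_smul, Finset.sum_add_distrib, Pi.single_apply, ite_smul]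

lemma avgAdjusted_signVec (ρ : Randomness n ℓ b) (i : Fin n) (S : Finset (Fin n))
    (z : Fin n → Bool) : avgAdjusted ρ i (signVec S z) =
      signedSum S (fun i' => (1 / (ℓ : ℝ)) * (patternOf ρ i).inner (patternOf ρ i')) z := by
  rw [avgAdjusted_eq, ← sum_signVec_smul, Finset.mul_sum]
  exact Finset.sum_congr rfl fun i' _ => by rw [smul_eq_mul]; ring

lemma expect_abs_avgAdjusted_signVec_le (hℓ : 0 < ℓ) (ρ : Randomness n ℓ b) (i : Fin n)
    (S : Finset (Fin n)) : (𝔼 z, |avgAdjusted ρ i (signVec S z)|) ≤ √(S.card : ℝ) := by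
  simp_rw [avgAdjusted_signVec]
  refine Real.le_sqrt_of_sq_le ((expect_abs_signedSum_sq_le _ _).trans ?_)
  have : ∀ i' ∈ S, ((1 / (ℓ : ℝ)) * (patternOf ρ i).inner (patternOf ρ i')) ^ 2 ≤ 1 := by
    intro i' _
    rw [sq_le_one_iff_abs_le_one, abs_mul, abs_of_nonneg (by positivity)]
    have h := (patternOf ρ i).abs_inner_le (patternOf ρ i')
    rw [one_div_mul_eq_div, div_le_one (by positivity)]
    exact h
  simpa using Finset.sum_le_sum this

variable [NeZero b]

/-- If the pattern counts are balanced, then the correlation of the average adjusted measurement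
with a function of the sketch is, up to scaling, a difference of averages of that function. -/
lemma abs_smoothed_sub_expect_avgAdjusted_le (hℓ : 0 < ℓ) (ρ : Randomness n ℓ b) (i : Fin n)
    (S : Finset (Fin n)) (f : (Fin ℓ → Fin b → ℝ) → ℝ) (hf : ∀ y, |f y| ≤ 1) (N η : ℝ)
    (hN : 0 < N) (hη0 : 0 ≤ η) (hη : η ≤ 1 / 2)
    (hbal : ∀ p, |((keysWith ρ S p).card : ℝ) - N| ≤ η * N) (y : Fin ℓ → Fin b → ℝ) :
    |N * (smoothed S (fun i => (patternOf ρ i).vec) f y -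
          smoothed S (fun i => (patternOf ρ i).vec) f
            (y - (2 * Fintype.card (Pattern ℓ b) / b : ℝ) • (patternOf ρ i).vec)) -
        2 * ℓ * 𝔼 z, avgAdjusted ρ i (signVec S z) *
          f (y + signedSum S (fun i => (patternOf ρ i).vec) z)| ≤
      (ℓ * Fintype.card (Pattern ℓ b) : ℝ) *
        (6 + 3 * η * √N + 12 * (ℓ * Fintype.card (Pattern ℓ b) : ℝ)) := by
  set g := patternOf ρ i with hg
  -- One shift for every row and pattern, weighted by the row's share of the inner product with `g`;
  -- this splitting keeps all weights in {-1, 0, 1}. The total shift is parallel to `g` by isotropy.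
  have h := abs_smoothed_sub_sum_le S (fun a : Fin ℓ × Pattern ℓ b => keysWith ρ S a.2)
    (fun a => Finset.filter_subset _ _) (fun i => (patternOf ρ i).vec) (fun a => a.2.vec)
    (fun a i' hi' => by rw [(Finset.mem_filter.1 hi').2]) f hf N η hN hη0 hη (fun a => hbal a.2)
    (fun a => g.rowInner a.2 a.1) (fun a => g.rowInner_cases a.2 a.1) y Finset.univ
  rw [sum_rowInner_smul_vec] at h
  -- Summing over rows restores the full inner product, and grouping the keys of `S` by pattern
  -- restores ℓ times the average adjusted measurement.
  have e : (∑ a : Fin ℓ × Pattern ℓ b, g.rowInner a.2 a.1 *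
      weighted S (fun i => (patternOf ρ i).vec) f (keysWith ρ S a.2) y) =
      ℓ * 𝔼 z, avgAdjusted ρ i (signVec S z) *
          f (y + signedSum S (fun i => (patternOf ρ i).vec) z) := by
    simp_rw [weighted, Finset.mul_expect]
    rw [← Finset.expect_sum_comm]
    refine Finset.expect_congr rfl fun z _ => ?_
    simp_rw [← mul_assoc, ← Finset.sum_mul]
    congr 1
    rw [← Finset.univ_product_univ, Finset.sum_product_right]
    have e1 : ∀ p, (∑ j, g.rowInner p j * signedSum (keysWith ρ S p) (fun _ => (1 : ℝ)) z) =
        ∑ i' ∈ keysWith ρ S p, g.inner (patternOf ρ i') * sgn (z i') := by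
      intro p
      rw [← Finset.sum_mul, signedSum_one, Finset.mul_sum]
      refine Finset.sum_congr rfl fun i' hi' => ?_
      rw [(Finset.mem_filter.1 hi').2, Pattern.inner]
    simp_rw [e1, keysWith]
    rw [Finset.sum_fiberwise S (patternOf ρ) fun i' => g.inner (patternOf ρ i') * sgn (z i'),
      avgAdjusted_signVec, signedSum, Finset.mul_sum]
    refine Finset.sum_congr rfl fun i' _ => ?_
    have : (ℓ : ℝ) ≠ 0 := by positivity
    rw [smul_eq_mul, ← hg]
    field_simp
  rw [e, ← mul_assoc] at h
  simpa using h

end SingleQuery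

/-- The integral of a difference `φ x - φ (x - s)` only involves both ends of the interval. -/
lemma integral_sub_shift (φ : ℝ → ℝ) (hφ : ∀ a b : ℝ, IntervalIntegrable φ volume a b)
    (s l u : ℝ) : ∫ x in l..u, (φ x - φ (x - s)) =
      (∫ x in (u - s)..u, φ x) - ∫ x in (l - s)..l, φ x := by
  have hs : IntervalIntegrable (fun x => φ (x - s)) volume l u := by
    simpa using (hφ (l - s) (u - s)).comp_sub_right s
  rw [intervalIntegral.integral_sub (hφ _ _) hs, intervalIntegral.integral_comp_sub_right]
  have h1 := intervalIntegral.integral_add_adjacent_intervals (hφ (l - s) l) (hφ l u)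
  have h2 := intervalIntegral.integral_add_adjacent_intervals (hφ (l - s) (u - s)) (hφ (u - s) u)
  linarith

/-- The pointwise estimate integrated over the range of the key value; only the behaviour of φ near
the two endpoints survives. -/
lemma abs_integral_shift_sub_le (φ ψ : ℝ → ℝ) (hφ : ∀ a b : ℝ, IntervalIntegrable φ volume a b)
    (hψ : ∀ a b : ℝ, IntervalIntegrable ψ volume a b) (s l u N K E : ℝ) (hlu : l ≤ u)
    (h : ∀ x, |N * (φ x - φ (x - s)) - K * ψ x| ≤ E) :
    |N * ((∫ x in (u - s)..u, φ x) - ∫ x in (l - s)..l, φ x) - K * ∫ x in l..u, ψ x| ≤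
      E * (u - l) := by
  have hs : IntervalIntegrable (fun x => φ (x - s)) volume l u := by
    simpa using (hφ (l - s) (u - s)).comp_sub_right s
  rw [← integral_sub_shift φ hφ, ← intervalIntegral.integral_const_mul,
    ← intervalIntegral.integral_const_mul, ← intervalIntegral.integral_sub
      (((hφ l u).sub hs).const_mul N) ((hψ l u).const_mul K)]
  have := intervalIntegral.norm_integral_le_of_norm_le_const (a := l) (b := u) (C := E)
    (f := fun x => N * (φ x - φ (x - s)) - K * ψ x) fun x _ => h x
  rwa [abs_of_nonneg (sub_nonneg.2 hlu), Real.norm_eq_abs] at this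

/-- The uniform distribution on an interval. -/
lemma integral_cond_Icc (F : ℝ → ℝ) {l u : ℝ} (hlu : l < u) :
    ∫ x, F x ∂(ProbabilityTheory.cond volume (Set.Icc l u)) = (u - l)⁻¹ * ∫ x in l..u, F x := by
  rw [ProbabilityTheory.cond, integral_smul_measure, intervalIntegral.integral_of_le hlu.le,
    integral_Icc_eq_integral_Ioc, Real.volume_Icc, ENNReal.toReal_inv,
    ENNReal.toReal_ofReal (by linarith), smul_eq_mul]

/-! ### Resampling a coordinate -/

section Resampling

lemma measurePreserving_update {ι α : Type*} [Fintype ι] [DecidableEq ι] [MeasurableSpace α]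
    (μ : Measure α) [IsProbabilityMeasure μ] (t : ι) :
    MeasurePreserving (fun p : (ι → α) × α => Function.update p.1 t p.2)
      ((Measure.pi fun _ : ι => μ).prod μ) (Measure.pi fun _ : ι => μ) := by
  have hm : Measurable (fun p : (ι → α) × α => Function.update p.1 t p.2) := by
    refine measurable_pi_iff.2 fun i => ?_
    by_cases h : i = t
    · subst h; simpa using measurable_snd
    · simp only [Function.update_of_ne h]
      exact (measurable_pi_apply i).comp measurable_fst
  refine ⟨hm, (Measure.pi_eq fun s hs => ?_).symm⟩
  rw [Measure.map_apply hm (MeasurableSet.univ_pi hs)]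
  have : (fun p : (ι → α) × α => Function.update p.1 t p.2) ⁻¹' Set.univ.pi s =
      (Set.univ.pi (Function.update s t Set.univ)) ×ˢ s t := by
    ext p
    simp only [mem_preimage, Set.mem_pi, mem_univ, true_implies, mem_prod]
    constructor
    · intro h
      refine ⟨fun i => ?_, by simpa using h t⟩
      by_cases hi : i = t
      · subst hi; simp
      · simpa [Function.update_of_ne hi] using h i
    · rintro ⟨h1, h2⟩ i
      by_cases hi : i = t
      · subst hi; simpa using h2
      · simpa [Function.update_of_ne hi] using h1 i
  rw [this, Measure.prod_prod, Measure.pi_pi, ← Finset.mul_prod_erase Finset.univ _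
    (Finset.mem_univ t), ← Finset.mul_prod_erase Finset.univ (fun i => μ (s i))
    (Finset.mem_univ t)]
  have : ∏ i ∈ Finset.univ.erase t, μ (Function.update s t Set.univ i) =
      ∏ i ∈ Finset.univ.erase t, μ (s i) :=
    Finset.prod_congr rfl fun i hi => by rw [Function.update_of_ne (Finset.ne_of_mem_erase hi)]
  rw [this]
  simp [mul_comm]

variable {α β γ δ : Type*} [MeasurableSpace α] [MeasurableSpace β] [MeasurableSpace γ]
  [MeasurableSpace δ] {μ : Measure α} {ν : Measure β} {κ : Measure γ} {τ : Measure δ}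
  [SFinite μ] [SFinite ν] [SFinite κ] [SFinite τ]

/-- This and the next two lemmas lift the redrawing of one factor to nested products, as needed for
the tuple that describes a run. -/
lemma measurePreserving_right {u : β × γ → β} (hu : MeasurePreserving u (ν.prod κ) ν) :
    MeasurePreserving (fun p : (α × β) × γ => (p.1.1, u (p.1.2, p.2))) ((μ.prod ν).prod κ)
      (μ.prod ν) :=
  ((MeasurePreserving.id μ).prod hu).comp (measurePreserving_prodAssoc μ ν κ)

lemma measurePreserving_left {u : α × γ → α} (hu : MeasurePreserving u (μ.prod κ) μ) :
    MeasurePreserving (fun p : (α × β) × γ => (u (p.1.1, p.2), p.1.2)) ((μ.prod ν).prod κ)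
      (μ.prod ν) := by
  have h1 := measurePreserving_prodAssoc μ ν κ
  have h2 := (MeasurePreserving.id μ).prod (Measure.measurePreserving_swap (μ := ν) (ν := κ))
  have h3 := (measurePreserving_prodAssoc μ κ ν).symm
  exact (hu.prod (MeasurePreserving.id ν)).comp (h3.comp (h2.comp h1))

lemma measurePreserving_both {u : α × γ → α} {v : β × δ → β}
    (hu : MeasurePreserving u (μ.prod κ) μ) (hv : MeasurePreserving v (ν.prod τ) ν) :
    MeasurePreserving (fun p : (α × β) × γ × δ => (u (p.1.1, p.2.1), v (p.1.2, p.2.2)))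
      ((μ.prod ν).prod (κ.prod τ)) (μ.prod ν) := by
  have h1 := (measurePreserving_prodAssoc (μ.prod ν) κ τ).symm
  have h2 := (measurePreserving_left (ν := ν) hu).prod (MeasurePreserving.id τ)
  exact (measurePreserving_right (μ := μ) hv).comp (h2.comp h1)

end Resampling

/-! ### Runs of the attack -/

section Runs

variable {n ℓ b r : ℕ} {A : QueryResponse.{u} n ℓ b r}

/-- Runs are equivalent to the tuples of their components. -/
def runEquiv (A : QueryResponse.{u} n ℓ b r) :
    Run A ≃ᵐ Randomness n ℓ b × (Fin n × (Fin r → Finset (Fin n))) × (Fin r → Fin n → Bool) ×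
      (Fin r → ℝ) × A.Seed where
  toFun := Run.toTuple
  invFun := Run.ofTuple
  left_inv _ := rfl
  right_inv _ := rfl
  measurable_toFun := comap_measurable _
  measurable_invFun := measurable_comap_iff.2 measurable_id

lemma measurable_toTuple : Measurable (Run.toTuple (A := A)) := comap_measurable _

lemma measurable_ofTuple : Measurable (Run.ofTuple (A := A)) := (runEquiv A).symm.measurable

lemma measurable_to_run {α : Type*} [MeasurableSpace α] {f : α → Run A}
    (h : Measurable fun x => (f x).toTuple) : Measurable f := measurable_comap_iff.2 h

@[fun_prop] lemma Run.measurable_ρ : Measurable fun ω : Run A => ω.ρ :=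
  measurable_fst.comp measurable_toTuple

@[fun_prop] lemma Run.measurable_h : Measurable fun ω : Run A => ω.h :=
  measurable_fst.comp (measurable_fst.comp (measurable_snd.comp measurable_toTuple))

@[fun_prop] lemma Run.measurable_supp : Measurable fun ω : Run A => ω.supp :=
  measurable_snd.comp (measurable_fst.comp (measurable_snd.comp measurable_toTuple))

@[fun_prop] lemma Run.measurable_sign : Measurable fun ω : Run A => ω.sign :=
  measurable_fst.comp (measurable_snd.comp (measurable_snd.comp measurable_toTuple))

@[fun_prop] lemma Run.measurable_val : Measurable fun ω : Run A => ω.val :=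
  measurable_fst.comp (measurable_snd.comp (measurable_snd.comp (measurable_snd.comp
    measurable_toTuple)))

@[fun_prop] lemma Run.measurable_seed : Measurable fun ω : Run A => ω.seed :=
  measurable_snd.comp (measurable_snd.comp (measurable_snd.comp (measurable_snd.comp
    measurable_toTuple)))

lemma measurable_sketch : Measurable fun p : Randomness n ℓ b × (Fin n → ℝ) => sketch p.1 p.2 := by
  refine measurable_pi_iff.2 fun j => measurable_pi_iff.2 fun k => ?_
  change Measurable fun p : Randomness n ℓ b × (Fin n → ℝ) => ∑ i, measVec p.1 j k i * p.2 i
  refine Finset.measurable_fun_sum _ fun i _ => Measurable.mul ?_ ?_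
  · exact (Measurable.of_discrete (f := fun ρ : Randomness n ℓ b => measVec ρ j k i)).comp
      measurable_fst
  · exact (measurable_pi_apply i).comp measurable_snd

lemma measurable_queryResponse (A : QueryResponse.{u} n ℓ b r) (t : Fin r) :
    Measurable fun p : A.Seed × Randomness n ℓ b × Fin n × (Fin r → Fin n → ℝ) =>
      A.response p.1 p.2.1 p.2.2.1 p.2.2.2 t := by
  induction t using WellFoundedLT.induction with
  | ind t ih =>
    have hg : Measurable fun p : A.Seed × Randomness n ℓ b × Fin n × (Fin r → Fin n → ℝ) =>
        (p.1, p.2.1, p.2.2.1, (fun i : Set.Iio t => (p.2.2.2 i.1,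
          A.response p.1 p.2.1 p.2.2.1 p.2.2.2 i.1)), sketch p.2.1 (p.2.2.2 t)) := by
      refine measurable_fst.prodMk ((measurable_fst.comp measurable_snd).prodMk
        ((measurable_fst.comp (measurable_snd.comp measurable_snd)).prodMk
        (Measurable.prodMk ?_ ?_)))
      · refine measurable_pi_iff.2 fun i => Measurable.prodMk ?_ (ih i.1 i.2)
        fun_prop
      · exact measurable_sketch.comp (Measurable.prodMk (by fun_prop) (by fun_prop))
    have h := (A.measurable_estimator t).comp hg
    convert h using 2 with p
    rw [QueryResponse.response]
    rfl

/-- Causality: although the algorithm is adaptive, its answer at step `t` cannot depend on later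
queries. The martingale structure rests on this. -/
lemma response_congr (A : QueryResponse.{u} n ℓ b r) (seed : A.Seed) (ρ : Randomness n ℓ b)
    (h : Fin n) (q q' : Fin r → Fin n → ℝ) (t : Fin r) (hq : ∀ i ≤ t, q i = q' i) :
    A.response seed ρ h q t = A.response seed ρ h q' t := by
  induction t using WellFoundedLT.induction with
  | ind t ih =>
    rw [QueryResponse.response, QueryResponse.response, hq t le_rfl]
    congr 1
    funext i
    rw [hq i.1 (le_of_lt i.2), ih i.1 i.2 fun k hk => hq k (hk.trans (le_of_lt i.2))]

lemma Run.tail_eq (ω : Run A) (t : Fin r) : ω.tail t = signVec (ω.supp t) (ω.sign t) := rfl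

lemma Run.measurable_tail (t : Fin r) : Measurable fun ω : Run A => ω.tail t := by
  have h : Measurable fun p : (Fin r → Finset (Fin n)) × (Fin r → Fin n → Bool) =>
      signVec (p.1 t) (p.2 t) := Measurable.of_discrete
  exact h.comp (Run.measurable_supp.prodMk Run.measurable_sign)

lemma Run.measurable_query (t : Fin r) : Measurable fun ω : Run A => ω.query t := by
  refine Measurable.add ?_ (Run.measurable_tail t)
  refine measurable_pi_iff.2 fun i => ?_
  have h : ∀ ω : Run A, (Pi.single ω.h (ω.val t) : Fin n → ℝ) i =
      (if i = ω.h then 1 else 0) * ω.val t := fun ω => by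
    simp [Pi.single_apply]
  simp_rw [h]
  refine Measurable.mul ?_ (by fun_prop)
  exact (Measurable.of_discrete (f := fun k : Fin n => if i = k then (1 : ℝ) else 0)).comp
    Run.measurable_h

lemma Run.measurable_s (t : Fin r) : Measurable fun ω : Run A => ω.s t := by
  have h1 : Measurable fun ω : Run A => ω.response t := by
    refine (measurable_queryResponse A t).comp (Run.measurable_seed.prodMk
      (Run.measurable_ρ.prodMk (Run.measurable_h.prodMk ?_)))
    exact measurable_pi_iff.2 Run.measurable_query
  exact (Measurable.of_discrete (f := fun p : Fin n × Finset (Fin n) =>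
    if p.1 ∈ p.2 then (1 : ℝ) else -1)).comp (Run.measurable_h.prodMk h1)

lemma Run.abs_s (ω : Run A) (t : Fin r) : |ω.s t| = 1 := by
  unfold Run.s; split_ifs <;> simp

lemma Run.s_sq (ω : Run A) (t : Fin r) : ω.s t ^ 2 = 1 := by
  unfold Run.s; split_ifs <;> simp

/-- The same run, with the signs and the value of query `t` replaced. -/
def Run.resample (ω : Run A) (t : Fin r) (y : (Fin n → Bool) × ℝ) : Run A :=
  { ω with sign := Function.update ω.sign t y.1, val := Function.update ω.val t y.2 }

lemma Run.query_resample_of_ne (ω : Run A) {t i : Fin r} (h : i ≠ t) (y : (Fin n → Bool) × ℝ) :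
    (ω.resample t y).query i = ω.query i := by
  simp [Run.query, Run.tail_eq, Run.resample, Function.update_of_ne h]

lemma Run.s_congr (ω ω' : Run A) (t : Fin r) (h1 : ω.seed = ω'.seed) (h2 : ω.ρ = ω'.ρ)
    (h3 : ω.h = ω'.h) (h4 : ∀ i ≤ t, ω.query i = ω'.query i) : ω.s t = ω'.s t := by
  unfold Run.s Run.response
  rw [h1, h2, h3, response_congr A _ _ _ _ _ t h4]

lemma Run.s_resample_of_lt (ω : Run A) {t t' : Fin r} (h : t < t') (y : (Fin n → Bool) × ℝ) :
    (ω.resample t' y).s t = ω.s t :=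
  Run.s_congr _ _ _ rfl rfl rfl fun _ hi => ω.query_resample_of_ne (hi.trans_lt h).ne y

lemma Run.resample_resample (ω : Run A) (t : Fin r) (y y' : (Fin n → Bool) × ℝ) :
    (ω.resample t y).resample t y' = ω.resample t y' := by
  simp [Run.resample]

lemma Run.resample_comm (ω : Run A) {t t' : Fin r} (h : t ≠ t') (y y' : (Fin n → Bool) × ℝ) :
    (ω.resample t y).resample t' y' = (ω.resample t' y').resample t y := by
  simp [Run.resample, Function.update_comm h]

lemma measurable_resample (t : Fin r) :
    Measurable fun p : Run A × (Fin n → Bool) × ℝ => p.1.resample t p.2 := by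
  refine measurable_to_run ?_
  have hu : ∀ {α : Type} [MeasurableSpace α], Measurable fun p : (Fin r → α) × α =>
      Function.update p.1 t p.2 := fun {α} _ => by
    refine measurable_pi_iff.2 fun i => ?_
    by_cases h : i = t
    · subst h; simpa using measurable_snd
    · simp only [Function.update_of_ne h]
      exact (measurable_pi_apply i).comp measurable_fst
  unfold Run.toTuple Run.resample
  refine Measurable.prodMk (by fun_prop) (Measurable.prodMk (by fun_prop) (Measurable.prodMk ?_
    (Measurable.prodMk ?_ (by fun_prop))))
  · exact hu.comp (Measurable.prodMk (by fun_prop) (by fun_prop))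
  · exact hu.comp (Measurable.prodMk (by fun_prop) (by fun_prop))

/-- The law of the signs and the value in one query. -/
def stepLaw (n b m : ℕ) (a c : ℝ) : Measure ((Fin n → Bool) × ℝ) :=
  (uniformOn (Set.univ : Set (Fin n → Bool))).prod
    (ProbabilityTheory.cond volume (Set.Icc (a * scale m b) ((c + 2 * a) * scale m b)))

instance {α : Type*} [Finite α] [Nonempty α] [MeasurableSpace α] [MeasurableSingletonClass α] :
    IsProbabilityMeasure (uniformOn (Set.univ : Set α)) :=
  isProbabilityMeasure_uniformOn Set.finite_univ Set.univ_nonempty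

lemma isProbabilityMeasure_cond_Icc {x y : ℝ} (h : x < y) :
    IsProbabilityMeasure (ProbabilityTheory.cond volume (Set.Icc x y)) := by
  refine cond_isProbabilityMeasure_of_finite ?_ ?_
  · rw [Real.volume_Icc]; simpa using h
  · rw [Real.volume_Icc]; exact ENNReal.ofReal_ne_top

/-- Needed for the uniform law on supports to be a probability measure. -/
lemma supports_nonempty {n m r : ℕ} (hn : r * m + 1 ≤ n) : (supports n m r).Nonempty := by
  have hlt : ∀ (t : Fin r) (i : Fin m), (t : ℕ) * m + i + 1 < n := by
    intro t i
    have h1 : ((t : ℕ) + 1) * m ≤ r * m := Nat.mul_le_mul_right _ t.2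
    have := i.2
    nlinarith
  -- Key 0 is kept for the special key, and the supports are consecutive blocks of length m starting
  -- at key 1; this is where n ≥ rm + 1 enters.
  let e : Fin r × Fin m → Fin n := fun p => ⟨p.1 * m + p.2 + 1, hlt p.1 p.2⟩
  have he : Function.Injective e := by
    rintro ⟨t, i⟩ ⟨t', i'⟩ h
    have h1 : (t : ℕ) * m + i = t' * m + i' := by
      have := congrArg Fin.val h
      simp only [e] at this
      omega
    have hm : 0 < m := i.pos
    have h2 : (t : ℕ) = t' := by
      have := congrArg (· / m) h1
      simpa [Nat.add_div_of_dvd_right (Dvd.intro_left _ rfl), Nat.mul_div_cancel _ hm,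
        Nat.div_eq_of_lt i.2, Nat.div_eq_of_lt i'.2] using this
    have h3 : (i : ℕ) = i' := by rw [h2] at h1; omega
    exact Prod.ext (Fin.ext h2) (Fin.ext h3)
  refine ⟨(⟨0, by omega⟩, fun t => Finset.univ.map ⟨fun i => e (t, i), fun i i' h => by
    simpa using he h⟩), fun t => ⟨by simp, ?_⟩, ?_⟩
  · simp [e, Fin.ext_iff]
  · intro t t' hne
    rw [Finset.disjoint_left]
    simp only [Finset.mem_map, Finset.mem_univ, true_and]
    rintro x ⟨i, rfl⟩ ⟨i', h⟩
    exact hne (by simpa using (congrArg Prod.fst (he h)).symm)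

/-- The parameters for which the laws of the attack are probability measures. -/
structure Admissible (n b m r : ℕ) (a c : ℝ) : Prop where
  b_pos : 0 < b
  m_pos : 0 < m
  a_pos : 0 < a
  a_lt : a < c
  le_n : r * m + 1 ≤ n

variable {m : ℕ} {a c : ℝ}

lemma Admissible.scale_pos (H : Admissible n b m r a c) : 0 < scale m b :=
  Real.sqrt_pos.2 (div_pos (Nat.cast_pos.2 H.m_pos) (Nat.cast_pos.2 H.b_pos))

lemma Admissible.lt (H : Admissible n b m r a c) :
    a * scale m b < (c + 2 * a) * scale m b := by
  have := H.a_pos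
  have := H.a_lt
  exact mul_lt_mul_of_pos_right (by linarith) H.scale_pos

lemma Admissible.isProbabilityMeasure_stepLaw (H : Admissible n b m r a c) :
    IsProbabilityMeasure (stepLaw n b m a c) := by
  have := isProbabilityMeasure_cond_Icc H.lt
  unfold stepLaw
  infer_instance

lemma Admissible.isProbabilityMeasure_supports (H : Admissible n b m r a c) :
    IsProbabilityMeasure (uniformOn (supports n m r)) :=
  isProbabilityMeasure_uniformOn (Set.toFinite _) (supports_nonempty H.le_n)

lemma Admissible.isProbabilityMeasure_randomnessLaw (H : Admissible n b m r a c) :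
    IsProbabilityMeasure (randomnessLaw n ℓ b) := by
  have : NeZero b := ⟨H.b_pos.ne'⟩
  unfold randomnessLaw
  infer_instance

lemma Admissible.isProbabilityMeasure_runLaw (H : Admissible n b m r a c) :
    IsProbabilityMeasure (runLaw A m a c) := by
  have := isProbabilityMeasure_cond_Icc H.lt
  have := H.isProbabilityMeasure_supports
  have := H.isProbabilityMeasure_randomnessLaw (ℓ := ℓ)
  exact Measure.isProbabilityMeasure_map measurable_ofTuple.aemeasurable

/-- The signs and values of different queries are independent of each other and of the rest, so
redrawing those of one query preserves the law. Integrating over the redrawn part then acts as a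
conditional expectation, without any σ-algebras. -/
lemma measurePreserving_resample (H : Admissible n b m r a c) (t : Fin r) :
    MeasurePreserving (fun p : Run A × (Fin n → Bool) × ℝ => p.1.resample t p.2)
      ((runLaw A m a c).prod (stepLaw n b m a c)) (runLaw A m a c) := by
  have := isProbabilityMeasure_cond_Icc H.lt
  have := H.isProbabilityMeasure_supports
  have := H.isProbabilityMeasure_randomnessLaw (ℓ := ℓ)
  have := H.isProbabilityMeasure_stepLaw
  have := H.isProbabilityMeasure_runLaw (A := A)
  have hsign : uniformOn (Set.univ : Set (Fin r → Fin n → Bool)) =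
      Measure.pi fun _ => uniformOn (Set.univ : Set (Fin n → Bool)) := by
    rw [← uniformOn_pi, Set.pi_univ]
  have h1 := measurePreserving_update (uniformOn (Set.univ : Set (Fin n → Bool))) t
  rw [← hsign] at h1
  have h2 := measurePreserving_update
    (ProbabilityTheory.cond volume (Set.Icc (a * scale m b) ((c + 2 * a) * scale m b))) t
  have h3 := measurePreserving_both h1 (measurePreserving_left (ν := A.seedLaw) h2)
  have h4 := measurePreserving_right (μ := randomnessLaw n ℓ b)
    (measurePreserving_right (μ := uniformOn (supports n m r)) h3)
  have hof : MeasurePreserving (Run.ofTuple (A := A)) _ (runLaw A m a c) :=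
    measurable_ofTuple.measurePreserving _
  have hto : MeasurePreserving (Run.toTuple (A := A)) (runLaw A m a c) _ :=
    MeasurePreserving.symm (runEquiv A).symm hof
  exact hof.comp (h4.comp (hto.prod (MeasurePreserving.id _)))

end Runs

/-! ### Decomposition of X into conditional means and martingale differences. -/

section Steps

variable {n ℓ b r : ℕ} {A : QueryResponse.{u} n ℓ b r} {m : ℕ} {a c : ℝ}

/-- The contribution of query `t` to the average adjusted measurement of the output. -/
def Run.step (ω : Run A) (t : Fin r) : ℝ := ω.s t * avgAdjusted ω.ρ ω.h (ω.tail t)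

lemma avgAdjusted_output (ρ : Randomness n ℓ b) (ω : Run A) :
    avgAdjusted ρ ω.h ω.output = ∑ t, ω.s t * avgAdjusted ρ ω.h (ω.tail t) := by
  simp_rw [avgAdjusted_eq, Run.output, Finset.sum_apply, Pi.smul_apply, smul_eq_mul,
    Finset.sum_mul, Finset.mul_sum]
  rw [Finset.sum_comm]
  refine Finset.sum_congr rfl fun t _ => Finset.sum_congr rfl fun i _ => ?_
  ring

/-- All arguments range over finite types. The constant depends on n and serves only integrability.
-/
lemma exists_abs_avgAdjusted_le (n ℓ b : ℕ) : ∃ C : ℝ, ∀ (ρ : Randomness n ℓ b) (i : Fin n)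
    (S : Finset (Fin n)) (z : Fin n → Bool), |avgAdjusted ρ i (signVec S z)| ≤ C := by
  obtain ⟨C, hC⟩ := (Set.finite_range fun p : Randomness n ℓ b × Fin n × Finset (Fin n) ×
    (Fin n → Bool) => |avgAdjusted p.1 p.2.1 (signVec p.2.2.1 p.2.2.2)|).bddAbove
  exact ⟨C, fun ρ i S z => hC ⟨(ρ, i, S, z), rfl⟩⟩

lemma Run.abs_step (ω : Run A) (t : Fin r) :
    |ω.step t| = |avgAdjusted ω.ρ ω.h (ω.tail t)| := by
  rw [Run.step, abs_mul, Run.abs_s, one_mul]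

lemma Run.step_sq (ω : Run A) (t : Fin r) :
    ω.step t ^ 2 = avgAdjusted ω.ρ ω.h (ω.tail t) ^ 2 := by
  rw [Run.step, mul_pow, Run.s_sq, one_mul]

lemma exists_abs_step_le (n ℓ b : ℕ) : ∃ C : ℝ, ∀ (r : ℕ) (A : QueryResponse.{u} n ℓ b r)
    (ω : Run A) (t : Fin r), |ω.step t| ≤ C := by
  obtain ⟨C, hC⟩ := exists_abs_avgAdjusted_le n ℓ b
  exact ⟨C, fun r A ω t => (ω.abs_step t).le.trans (hC _ _ _ _)⟩

lemma measurable_avgAdjusted_tail (t : Fin r) :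
    Measurable fun p : Randomness n ℓ b × Run A => avgAdjusted p.1 p.2.h (p.2.tail t) := by
  have h : Measurable fun p : Randomness n ℓ b × Fin n × (Fin r → Finset (Fin n)) ×
      (Fin r → Fin n → Bool) => avgAdjusted p.1 p.2.1 (signVec (p.2.2.1 t) (p.2.2.2 t)) :=
    Measurable.of_discrete
  exact h.comp (f := fun p : Randomness n ℓ b × Run A => (p.1, p.2.h, p.2.supp, p.2.sign))
    (by fun_prop)

lemma Run.measurable_step (t : Fin r) : Measurable fun ω : Run A => ω.step t := by
  have h := (measurable_avgAdjusted_tail (A := A) t).comp (f := fun ω : Run A => (ω.ρ, ω))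
    (Run.measurable_ρ.prodMk measurable_id)
  exact (Run.measurable_s t).mul h

lemma Run.step_resample_of_lt (ω : Run A) {t t' : Fin r} (h : t < t') (y : (Fin n → Bool) × ℝ) :
    (ω.resample t' y).step t = ω.step t := by
  rw [Run.step, ω.s_resample_of_lt h, Run.step]
  congr 2
  simp [Run.tail_eq, Run.resample, Function.update_of_ne h.ne]

/-- The conditional expectation of the contribution of query `t` given everything but the signs
and the value in that query. -/
def Run.stepMean (m : ℕ) (a c : ℝ) (ω : Run A) (t : Fin r) : ℝ :=
  ∫ y, (ω.resample t y).step t ∂(stepLaw n b m a c)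

/-- Redrawing query `t` itself is overwritten by the redrawing inside `stepMean`, and redrawing a
later query does not affect step `t`. So `stepMean` behaves like a function of the past. -/
lemma Run.stepMean_resample (ω : Run A) {t t' : Fin r} (h : t ≤ t') (y : (Fin n → Bool) × ℝ) :
    (ω.resample t' y).stepMean m a c t = ω.stepMean m a c t := by
  unfold Run.stepMean
  rcases h.eq_or_lt with rfl | h
  · simp_rw [Run.resample_resample]
  · simp_rw [Run.resample_comm _ h.ne', Run.step_resample_of_lt _ h]

lemma Admissible.abs_stepMean_le (H : Admissible n b m r a c) {C : ℝ} (t : Fin r)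
    (hC : ∀ ω : Run A, |ω.step t| ≤ C) (ω : Run A) : |ω.stepMean m a c t| ≤ C := by
  have := H.isProbabilityMeasure_stepLaw
  have h := norm_integral_le_of_norm_le_const (μ := stepLaw n b m a c) (C := C)
    (f := fun y => (ω.resample t y).step t) (Filter.Eventually.of_forall fun y => hC _)
  simpa [Run.stepMean] using h

lemma Run.measurable_stepMean (H : Admissible n b m r a c) (t : Fin r) :
    Measurable fun ω : Run A => ω.stepMean m a c t := by
  have := H.isProbabilityMeasure_stepLaw
  have h : StronglyMeasurable fun p : Run A × (Fin n → Bool) × ℝ => (p.1.resample t p.2).step t :=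
    ((Run.measurable_step t).comp (measurable_resample t)).stronglyMeasurable
  exact h.integral_prod_right.measurable

lemma integrable_of_bounded {α : Type*} [MeasurableSpace α] {μ : Measure α} [IsFiniteMeasure μ]
    {F : α → ℝ} (hF : Measurable F) (C : ℝ) (hC : ∀ x, |F x| ≤ C) : Integrable F μ :=
  Integrable.of_bound hF.aestronglyMeasurable C (Filter.Eventually.of_forall hC)

lemma integral_comp_measurePreserving {α β : Type*} [MeasurableSpace α] [MeasurableSpace β]
    {μ : Measure α} {ν : Measure β} {f : α → β} (hf : MeasurePreserving f μ ν) {F : β → ℝ}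
    (hF : Measurable F) : ∫ x, F (f x) ∂μ = ∫ y, F y ∂ν := by
  rw [← hf.map_eq, integral_map hf.measurable.aemeasurable hF.aestronglyMeasurable]

lemma integral_resample (H : Admissible n b m r a c) (t : Fin r) {F : Run A → ℝ}
    (hF : Measurable F) (C : ℝ) (hC : ∀ ω, |F ω| ≤ C) :
    ∫ ω, ∫ y, F (ω.resample t y) ∂(stepLaw n b m a c) ∂(runLaw A m a c) =
      ∫ ω, F ω ∂(runLaw A m a c) := by
  have := H.isProbabilityMeasure_stepLaw
  have := H.isProbabilityMeasure_runLaw (A := A)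
  rw [← integral_comp_measurePreserving (measurePreserving_resample H t) hF, integral_prod]
  exact integrable_of_bounded (hF.comp (measurable_resample t)) C fun p => hC _

/-- `stepMean` is a conditional expectation of `step`. -/
lemma integral_mul_step (H : Admissible n b m r a c) (t : Fin r) {G : Run A → ℝ}
    (hG : Measurable G) (C : ℝ) (hC : ∀ ω, |G ω| ≤ C)
    (hinv : ∀ ω y, G (ω.resample t y) = G ω) :
    ∫ ω, G ω * ω.step t ∂(runLaw A m a c) = ∫ ω, G ω * ω.stepMean m a c t ∂(runLaw A m a c) := by
  obtain ⟨C', hC'⟩ := exists_abs_step_le.{u} n ℓ b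
  have hm : Measurable fun ω : Run A => G ω * ω.step t := hG.mul (Run.measurable_step t)
  rw [← integral_resample H t hm (C * C')]
  · simp_rw [hinv, integral_const_mul]
    rfl
  · intro ω
    rw [abs_mul]
    exact mul_le_mul (hC ω) (hC' _ _ _ _) (abs_nonneg _) ((abs_nonneg _).trans (hC ω))

lemma integral_step (H : Admissible n b m r a c) (t : Fin r) :
    ∫ ω, ω.step t ∂(runLaw A m a c) = ∫ ω, ω.stepMean m a c t ∂(runLaw A m a c) := by
  simpa using integral_mul_step (A := A) H t (G := fun _ => 1) measurable_const 1 (by simp)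
    (by simp)

/-- The centered contribution of query `t`. -/
def Run.noise (m : ℕ) (a c : ℝ) (ω : Run A) (t : Fin r) : ℝ := ω.step t - ω.stepMean m a c t

lemma Run.measurable_noise (H : Admissible n b m r a c) (t : Fin r) :
    Measurable fun ω : Run A => ω.noise m a c t :=
  (Run.measurable_step t).sub (Run.measurable_stepMean H t)

lemma exists_bounds (H : Admissible n b m r a c) : ∃ C : ℝ, 0 ≤ C ∧ ∀ (ω : Run A) (t : Fin r),
    |ω.step t| ≤ C ∧ |ω.stepMean m a c t| ≤ C ∧ |ω.noise m a c t| ≤ C := by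
  obtain ⟨C, hC⟩ := exists_abs_step_le.{u} n ℓ b
  refine ⟨2 * |C|, by positivity, fun ω t => ?_⟩
  have h1 := hC r A ω t
  have h2 := H.abs_stepMean_le t (fun ω => hC r A ω t) ω
  have h3 : |ω.noise m a c t| ≤ |ω.step t| + |ω.stepMean m a c t| := abs_sub _ _
  have := le_abs_self C
  have := abs_nonneg C
  refine ⟨?_, ?_, ?_⟩ <;> linarith

/-- The earlier noise is unchanged when the later query is redrawn, and the later noise averages to
zero under that redrawing. -/
lemma integral_noise_mul_noise (H : Admissible n b m r a c) {t t' : Fin r} (h : t < t') :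
    ∫ ω, ω.noise m a c t * ω.noise m a c t' ∂(runLaw A m a c) = 0 := by
  have := H.isProbabilityMeasure_runLaw (A := A)
  obtain ⟨C, hC0, hC⟩ := exists_bounds (A := A) H
  have hm := Run.measurable_noise (A := A) H t
  have e := integral_mul_step (A := A) H t' hm C (fun ω => (hC ω t).2.2) fun ω y => by
    rw [Run.noise, ω.step_resample_of_lt h, ω.stepMean_resample h.le, Run.noise]
  have hb : ∀ x y : ℝ, |x| ≤ C → |y| ≤ C → |x * y| ≤ C * C := fun x y hx hy => by
    rw [abs_mul]; exact mul_le_mul hx hy (abs_nonneg _) hC0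
  calc ∫ ω, ω.noise m a c t * ω.noise m a c t' ∂(runLaw A m a c)
      = ∫ ω, (ω.noise m a c t * ω.step t' - ω.noise m a c t * ω.stepMean m a c t')
          ∂(runLaw A m a c) := by
        refine integral_congr_ae (Filter.Eventually.of_forall fun ω => ?_)
        simp only [Run.noise]; ring
    _ = 0 := by
        rw [integral_sub, e, sub_self]
        · exact integrable_of_bounded (hm.mul (Run.measurable_step t')) (C * C)
            fun ω => hb _ _ (hC ω t).2.2 (hC ω t').1
        · exact integrable_of_bounded (hm.mul (Run.measurable_stepMean H t')) (C * C)
            fun ω => hb _ _ (hC ω t).2.2 (hC ω t').2.1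

lemma integral_noise_sq (H : Admissible n b m r a c) (t : Fin r) :
    ∫ ω, ω.noise m a c t ^ 2 ∂(runLaw A m a c) =
      ∫ ω, ω.step t ^ 2 ∂(runLaw A m a c) - ∫ ω, ω.stepMean m a c t ^ 2 ∂(runLaw A m a c) := by
  have := H.isProbabilityMeasure_runLaw (A := A)
  obtain ⟨C, hC0, hC⟩ := exists_bounds (A := A) H
  have hm := Run.measurable_stepMean (A := A) H t
  have hs := Run.measurable_step (A := A) t
  have e := integral_mul_step (A := A) H t hm C (fun ω => (hC ω t).2.1)
    fun ω y => ω.stepMean_resample le_rfl y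
  have hb : ∀ x y : ℝ, |x| ≤ C → |y| ≤ C → |x * y| ≤ C * C := fun x y hx hy => by
    rw [abs_mul]; exact mul_le_mul hx hy (abs_nonneg _) hC0
  have i1 : Integrable (fun ω : Run A => ω.step t ^ 2) (runLaw A m a c) :=
    integrable_of_bounded (hs.pow_const 2) (C * C) fun ω => by
      rw [sq]; exact hb _ _ (hC ω t).1 (hC ω t).1
  have i2 : Integrable (fun ω : Run A => ω.stepMean m a c t ^ 2) (runLaw A m a c) :=
    integrable_of_bounded (hm.pow_const 2) (C * C) fun ω => by
      rw [sq]; exact hb _ _ (hC ω t).2.1 (hC ω t).2.1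
  have i3 : Integrable (fun ω : Run A => ω.stepMean m a c t * ω.step t) (runLaw A m a c) :=
    integrable_of_bounded (hm.mul hs) (C * C) fun ω => hb _ _ (hC ω t).2.1 (hC ω t).1
  have e2 : ∀ ω : Run A, ω.noise m a c t ^ 2 =
      ω.step t ^ 2 + ω.stepMean m a c t ^ 2 - 2 * (ω.stepMean m a c t * ω.step t) := by
    intro ω; simp only [Run.noise]; ring
  simp_rw [e2]
  rw [integral_sub (by exact i1.add i2) (i3.const_mul 2), integral_add i1 i2, integral_const_mul, e]
  simp_rw [← sq]
  ring

lemma integral_sum_noise_sq (H : Admissible n b m r a c) :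
    ∫ ω, (∑ t, ω.noise m a c t) ^ 2 ∂(runLaw A m a c) =
      ∑ t, (∫ ω, ω.step t ^ 2 ∂(runLaw A m a c) -
        ∫ ω, ω.stepMean m a c t ^ 2 ∂(runLaw A m a c)) := by
  have := H.isProbabilityMeasure_runLaw (A := A)
  obtain ⟨C, hC0, hC⟩ := exists_bounds (A := A) H
  have hi : ∀ t t', Integrable (fun ω : Run A => ω.noise m a c t * ω.noise m a c t')
      (runLaw A m a c) := fun t t' =>
    integrable_of_bounded ((Run.measurable_noise H t).mul (Run.measurable_noise H t')) (C * C)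
      fun ω => by
        rw [abs_mul]
        exact mul_le_mul (hC ω t).2.2 (hC ω t').2.2 (abs_nonneg _) hC0
  simp_rw [← integral_noise_sq H, sq, Finset.sum_mul_sum]
  rw [integral_finsetSum _ fun t _ => integrable_finsetSum _ fun t' _ => hi t t']
  refine Finset.sum_congr rfl fun t _ => ?_
  rw [integral_finsetSum _ fun t' _ => hi t t', Finset.sum_eq_single_of_mem t (Finset.mem_univ t)]
  intro t' _ hne
  rcases lt_or_gt_of_ne hne with h | h
  · rw [← integral_noise_mul_noise (A := A) H h]
    exact integral_congr_ae (Filter.Eventually.of_forall fun ω => mul_comm _ _)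
  · exact integral_noise_mul_noise H h

/-! ### Averaging over the sketch randomness -/

lemma measurePreserving_resample_sketch (H : Admissible n b m r a c) :
    MeasurePreserving (fun p : Run A × Randomness n ℓ b => ({ p.1 with ρ := p.2 } : Run A))
      ((runLaw A m a c).prod (randomnessLaw n ℓ b)) (runLaw A m a c) := by
  have := isProbabilityMeasure_cond_Icc H.lt
  have := H.isProbabilityMeasure_supports
  have := H.isProbabilityMeasure_randomnessLaw (ℓ := ℓ)
  have := H.isProbabilityMeasure_runLaw (A := A)
  have hof : MeasurePreserving (Run.ofTuple (A := A)) _ (runLaw A m a c) :=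
    measurable_ofTuple.measurePreserving _
  have hto : MeasurePreserving (Run.toTuple (A := A)) (runLaw A m a c) _ :=
    MeasurePreserving.symm (runEquiv A).symm hof
  have h : MeasurePreserving (Prod.snd : Randomness n ℓ b × Randomness n ℓ b → _)
    ((randomnessLaw n ℓ b).prod (randomnessLaw n ℓ b)) (randomnessLaw n ℓ b) :=
    measurePreserving_snd
  exact hof.comp ((measurePreserving_left h).comp (hto.prod (MeasurePreserving.id _)))

/-- The key, supports and signs are independent of ρ, so ρ may be averaged out first. Functionals
involving the answers are excluded, since these depend on ρ. -/
lemma integral_run_sketch [NeZero b] (H : Admissible n b m r a c)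
    (G : Randomness n ℓ b → Fin n → (Fin r → Finset (Fin n)) → (Fin r → Fin n → Bool) → ℝ) :
    ∫ ω : Run A, G ω.ρ ω.h ω.supp ω.sign ∂(runLaw A m a c) =
      ∫ ω : Run A, (𝔼 ρ, G ρ ω.h ω.supp ω.sign) ∂(runLaw A m a c) := by
  have := H.isProbabilityMeasure_runLaw (A := A)
  have := H.isProbabilityMeasure_randomnessLaw (ℓ := ℓ)
  have hG : Measurable fun p : Randomness n ℓ b × Fin n × (Fin r → Finset (Fin n)) ×
      (Fin r → Fin n → Bool) => G p.1 p.2.1 p.2.2.1 p.2.2.2 := Measurable.of_discrete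
  have hF : Measurable fun ω : Run A => G ω.ρ ω.h ω.supp ω.sign :=
    hG.comp (f := fun ω : Run A => (ω.ρ, ω.h, ω.supp, ω.sign)) (by fun_prop)
  obtain ⟨C, hC⟩ := (Set.finite_range fun p : Randomness n ℓ b × Fin n ×
    (Fin r → Finset (Fin n)) × (Fin r → Fin n → Bool) => |G p.1 p.2.1 p.2.2.1 p.2.2.2|).bddAbove
  have hmp := measurePreserving_resample_sketch (A := A) H
  rw [← integral_comp_measurePreserving hmp hF, integral_prod]
  · simp_rw [randomnessLaw, integral_uniformOn_univ]
  · exact integrable_of_bounded (hF.comp hmp.measurable) C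
      fun p => hC ⟨(p.2, p.1.h, p.1.supp, p.1.sign), rfl⟩

lemma ae_mem_supports (H : Admissible n b m r a c) :
    ∀ᵐ ω ∂(runLaw A m a c), (ω.h, ω.supp) ∈ supports n m r := by
  have := isProbabilityMeasure_cond_Icc H.lt
  have := H.isProbabilityMeasure_supports
  have := H.isProbabilityMeasure_randomnessLaw (ℓ := ℓ)
  have hof : MeasurePreserving (Run.ofTuple (A := A)) _ (runLaw A m a c) :=
    measurable_ofTuple.measurePreserving _
  have hto : MeasurePreserving (Run.toTuple (A := A)) (runLaw A m a c) _ :=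
    MeasurePreserving.symm (runEquiv A).symm hof
  have h := (measurePreserving_fst.comp (measurePreserving_snd.comp hto)).quasiMeasurePreserving.ae
    (ae_cond_mem (μ := Measure.count) (Set.toFinite (supports n m r)).measurableSet)
  exact h

/-- Squaring removes the answer `s`. What remains is the adjusted measurement of a tail independent
of ρ, so the value is exact for every algorithm. -/
lemma integral_step_sq [NeZero b] (hℓ : 0 < ℓ) (H : Admissible n b m r a c) (t : Fin r) :
    ∫ ω : Run A, ω.step t ^ 2 ∂(runLaw A m a c) = m / (ℓ * b) := by
  have := H.isProbabilityMeasure_runLaw (A := A)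
  simp_rw [Run.step_sq, Run.tail_eq]
  rw [integral_run_sketch (A := A) H fun ρ h S z => avgAdjusted ρ h (signVec (S t) (z t)) ^ 2]
  have : ∀ᵐ ω ∂(runLaw A m a c), (𝔼 ρ : Randomness n ℓ b,
      avgAdjusted ρ ω.h (signVec (ω.supp t) (ω.sign t)) ^ 2) = m / (ℓ * b) := by
    filter_upwards [ae_mem_supports H] with ω hω
    rw [expect_avgAdjusted_sq hℓ _ _ (by simpa [signVec] using fun h => absurd h (hω.1 t).2),
      sum_signVec_sq, (hω.1 t).1]
  rw [integral_congr_ae this]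
  simp

lemma integral_imbalance_le [NeZero b] (H : Admissible n b m r a c) (t : Fin r) :
    ∫ ω : Run A, imbalance ω.ρ (ω.supp t) ∂(runLaw A m a c) ≤
      Fintype.card (Pattern ℓ b) * m := by
  have := H.isProbabilityMeasure_runLaw (A := A)
  rw [integral_run_sketch (A := A) H fun ρ h S z => imbalance ρ (S t)]
  have h : ∀ᵐ ω ∂(runLaw A m a c), (𝔼 ρ : Randomness n ℓ b, imbalance ρ (ω.supp t)) ≤
      Fintype.card (Pattern ℓ b) * m := by
    filter_upwards [ae_mem_supports H] with ω hω
    refine (expect_imbalance_le _).trans ?_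
    rw [(hω.1 t).1]
  have h2 := integral_mono_of_nonneg (Filter.Eventually.of_forall fun ω : Run A =>
    Finset.expect_nonneg fun ρ _ => imbalance_nonneg ρ (ω.supp t))
    (integrable_const (μ := runLaw A m a c) ((Fintype.card (Pattern ℓ b) : ℝ) * m)) h
  simpa using h2

lemma Run.integrable_imbalance (H : Admissible n b m r a c) (t : Fin r) :
    Integrable (fun ω : Run A => imbalance ω.ρ (ω.supp t)) (runLaw A m a c) := by
  have := H.isProbabilityMeasure_runLaw (A := A)
  obtain ⟨C, hC⟩ := (Set.finite_range fun p : Randomness n ℓ b × (Fin r → Finset (Fin n)) =>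
    |imbalance p.1 (p.2 t)|).bddAbove
  have h : Measurable fun p : Randomness n ℓ b × (Fin r → Finset (Fin n)) =>
    imbalance p.1 (p.2 t) := Measurable.of_discrete
  exact integrable_of_bounded (h.comp (f := fun ω : Run A => (ω.ρ, ω.supp)) (by fun_prop)) C
    fun ω => hC ⟨(ω.ρ, ω.supp), rfl⟩

end Steps

/-! ### Conditional means compared with the contrast between the ends of the range. -/

section Contrast

variable {n ℓ b r : ℕ} {A : QueryResponse.{u} n ℓ b r} {m : ℕ} {a c : ℝ}

/-- The average response at step `t` over the signs in that query, when the value is `x`. -/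
def Run.meanResponse (ω : Run A) (t : Fin r) (x : ℝ) : ℝ := 𝔼 z, (ω.resample t (z, x)).s t

/-- The size of the shift of the value that is compared with the correlation of the response and
the adjusted measurement. -/
def shiftSize (ℓ b : ℕ) : ℝ := 2 * Fintype.card (Pattern ℓ b) / b

/-- Half the difference of the average responses near the two ends of the range of the values. -/
def Run.contrast (m : ℕ) (a c : ℝ) (ω : Run A) (t : Fin r) : ℝ :=
  (1 / (2 * shiftSize ℓ b)) *
    ((∫ x in ((c + 2 * a) * scale m b - shiftSize ℓ b)..(c + 2 * a) * scale m b,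
        ω.meanResponse t x) -
      ∫ x in (a * scale m b - shiftSize ℓ b)..a * scale m b, ω.meanResponse t x)

/-- The estimator of step `t`, as the sign of its answer for the special key. -/
def Run.keyEstimator (ω : Run A) (t : Fin r) (y : Fin ℓ → Fin b → ℝ) : ℝ :=
  if ω.h ∈ A.estimator t ω.seed ω.ρ ω.h
    (fun i => (ω.query i.1, A.response ω.seed ω.ρ ω.h ω.query i.1)) y then 1 else -1

lemma Run.abs_keyEstimator_le (ω : Run A) (t : Fin r) (y : Fin ℓ → Fin b → ℝ) :
    |ω.keyEstimator t y| ≤ 1 := by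
  unfold Run.keyEstimator; split_ifs <;> simp

lemma Run.query_resample_self (ω : Run A) (t : Fin r) (y : (Fin n → Bool) × ℝ) :
    (ω.resample t y).query t = Pi.single ω.h y.2 + signVec (ω.supp t) y.1 := by
  simp [Run.query, Run.tail_eq, Run.resample]

/-- Redrawing query `t` leaves the history before `t` intact, so the estimator in force at step `t`
is one fixed function of the sketch. This reduces adaptive algorithms to the single-query estimate.
-/
lemma Run.s_resample (ω : Run A) (t : Fin r) (z : Fin n → Bool) (x : ℝ) :
    (ω.resample t (z, x)).s t = ω.keyEstimator t (x • (patternOf ω.ρ ω.h).vec +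
      signedSum (ω.supp t) (fun i => (patternOf ω.ρ i).vec) z) := by
  have hq : ∀ i < t, (ω.resample t (z, x)).query i = ω.query i := fun i hi =>
    ω.query_resample_of_ne hi.ne _
  unfold Run.s Run.response Run.keyEstimator
  rw [QueryResponse.response, Run.query_resample_self, ← sketch_query]
  have : (fun i : Set.Iio t => ((ω.resample t (z, x)).query i.1, A.response (ω.resample t (z, x)).seed
      (ω.resample t (z, x)).ρ (ω.resample t (z, x)).h (ω.resample t (z, x)).query i.1)) =
      fun i : Set.Iio t => (ω.query i.1, A.response ω.seed ω.ρ ω.h ω.query i.1) := by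
    funext i
    rw [hq i.1 i.2]
    exact congrArg _ (response_congr A _ _ _ _ _ _ fun k hk => hq k (lt_of_le_of_lt hk i.2))
  rw [this]
  rfl

lemma Run.step_resample (ω : Run A) (t : Fin r) (z : Fin n → Bool) (x : ℝ) :
    (ω.resample t (z, x)).step t = avgAdjusted ω.ρ ω.h (signVec (ω.supp t) z) *
      ω.keyEstimator t (x • (patternOf ω.ρ ω.h).vec +
        signedSum (ω.supp t) (fun i => (patternOf ω.ρ i).vec) z) := by
  rw [Run.step, Run.s_resample, mul_comm]
  simp [Run.tail_eq, Run.resample]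

lemma measurable_expect {α β : Type*} [MeasurableSpace α] [Fintype β] {F : β → α → ℝ}
    (h : ∀ y, Measurable (F y)) : Measurable fun x => 𝔼 y, F y x := by
  simp_rw [Fintype.expect_eq_sum_div_card]
  exact (Finset.measurable_fun_sum _ fun y _ => h y).div_const _

lemma Run.measurable_meanResponse (t : Fin r) :
    Measurable fun p : Run A × ℝ => p.1.meanResponse t p.2 :=
  measurable_expect fun z => (Run.measurable_s t).comp ((measurable_resample t).comp
    (f := fun p : Run A × ℝ => (p.1, z, p.2)) (by fun_prop))

lemma Run.abs_meanResponse_le (ω : Run A) (t : Fin r) (x : ℝ) : |ω.meanResponse t x| ≤ 1 := by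
  refine (Finset.abs_expect_le _ _).trans ?_
  exact Finset.expect_le Finset.univ_nonempty fun z _ => (Run.abs_s _ t).le

lemma intervalIntegrable_of_bounded {F : ℝ → ℝ} (hF : Measurable F) (C : ℝ) (hC : ∀ x, |F x| ≤ C)
    (x y : ℝ) : IntervalIntegrable F volume x y := by
  rw [intervalIntegrable_iff, uIoc]
  exact integrable_of_bounded hF C hC

lemma Run.intervalIntegrable_meanResponse (ω : Run A) (t : Fin r) (x y : ℝ) :
    IntervalIntegrable (ω.meanResponse t) volume x y :=
  intervalIntegrable_of_bounded ((Run.measurable_meanResponse t).comp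
    (f := fun x : ℝ => (ω, x)) (by fun_prop)) 1 (ω.abs_meanResponse_le t) x y

lemma shiftSize_pos [NeZero b] : 0 < shiftSize ℓ b := by
  have : 0 < b := NeZero.pos b
  have : 0 < Fintype.card (Pattern ℓ b) := Fintype.card_pos
  unfold shiftSize
  positivity

lemma Run.abs_contrast_le [NeZero b] (ω : Run A) (t : Fin r) : |ω.contrast m a c t| ≤ 1 := by
  have hs := shiftSize_pos (ℓ := ℓ) (b := b)
  have key : ∀ y : ℝ, |∫ x in (y - shiftSize ℓ b)..y, ω.meanResponse t x| ≤ shiftSize ℓ b := by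
    intro y
    have := intervalIntegral.norm_integral_le_of_norm_le_const (a := y - shiftSize ℓ b) (b := y)
      (C := 1) (f := ω.meanResponse t) fun x _ => ω.abs_meanResponse_le t x
    simpa [abs_of_pos hs] using this
  unfold Run.contrast
  rw [abs_mul, abs_of_pos (by positivity), one_div, inv_mul_le_iff₀ (by positivity)]
  refine (abs_sub _ _).trans ?_
  linarith [key ((c + 2 * a) * scale m b), key (a * scale m b)]

lemma Run.measurable_contrast (t : Fin r) : Measurable fun ω : Run A => ω.contrast m a c t := by
  have h : ∀ x y : ℝ, Measurable fun ω : Run A => ∫ v in x..y, ω.meanResponse t v := by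
    intro x y
    have hm := (Run.measurable_meanResponse (A := A) t).stronglyMeasurable
    exact (hm.integral_prod_right' (ν := volume.restrict (Ioc x y))).measurable.sub
      (hm.integral_prod_right' (ν := volume.restrict (Ioc y x))).measurable
  exact ((h _ _).sub (h _ _)).const_mul _

lemma Run.stepMean_eq (H : Admissible n b m r a c) (ω : Run A) (t : Fin r) :
    ω.stepMean m a c t = ((c + a) * scale m b)⁻¹ *
      ∫ x in (a * scale m b)..(c + 2 * a) * scale m b, 𝔼 z, (ω.resample t (z, x)).step t := by
  have := isProbabilityMeasure_cond_Icc H.lt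
  obtain ⟨C, hC⟩ := exists_abs_step_le.{u} n ℓ b
  have hm : Measurable fun y => (ω.resample t y).step t :=
    (Run.measurable_step t).comp ((measurable_resample t).comp
      (f := fun y : (Fin n → Bool) × ℝ => (ω, y)) (by fun_prop))
  unfold Run.stepMean stepLaw
  rw [integral_prod_symm _ (integrable_of_bounded hm C fun y => hC _ _ _ _)]
  simp_rw [integral_uniformOn_univ]
  rw [integral_cond_Icc _ H.lt]
  congr 2
  ring

lemma Run.measurable_expect_step (ω : Run A) (t : Fin r) :
    Measurable fun x : ℝ => 𝔼 z, (ω.resample t (z, x)).step t :=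
  measurable_expect fun z => (Run.measurable_step t).comp ((measurable_resample t).comp
    (f := fun x : ℝ => (ω, z, x)) (by fun_prop))

/-- A bound without any balance assumption, for the rare runs in which the pattern counts are far
from their mean. -/
lemma Run.abs_stepMean_le_sqrt (hℓ : 0 < ℓ) (H : Admissible n b m r a c) (ω : Run A) (t : Fin r)
    (hω : (ω.supp t).card = m) : |ω.stepMean m a c t| ≤ √(m : ℝ) := by
  have hlt := H.lt
  have hpos : 0 < (c + a) * scale m b := by linarith
  rw [Run.stepMean_eq H, abs_mul, abs_of_pos (inv_pos.2 hpos), inv_mul_le_iff₀ hpos]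
  have := intervalIntegral.norm_integral_le_of_norm_le_const (a := a * scale m b)
    (b := (c + 2 * a) * scale m b) (C := √(m : ℝ))
    (f := fun x => 𝔼 z, (ω.resample t (z, x)).step t) fun x _ => by
      simp_rw [Run.step_resample, Real.norm_eq_abs]
      refine (abs_expect_mul_le _ _ fun z => ω.abs_keyEstimator_le t _).trans ?_
      rw [← hω]
      exact expect_abs_avgAdjusted_signVec_le hℓ _ _ _
  rw [abs_of_pos (by linarith), Real.norm_eq_abs] at this
  refine this.trans (le_of_eq ?_)
  ring

/-- The expected increment of the correlation per query for a perfectly correct algorithm. -/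
def drift (ℓ b m : ℕ) (a c : ℝ) : ℝ := 2 * scale m b / (ℓ * (c + a))

/-- The single-query estimate integrated over the key value, with N = m/|Pattern|. The boundary
terms are 2s·`contrast`, and N·s = 2σ², so division by 2ℓ(c + a)σ turns them into `drift` times
`contrast`. -/
lemma Run.abs_stepMean_sub_contrast_le [NeZero b] (hℓ : 0 < ℓ) (H : Admissible n b m r a c)
    (ω : Run A) (t : Fin r) (η : ℝ) (hη0 : 0 ≤ η) (hη : η ≤ 1 / 2)
    (hbal : ∀ p, |((keysWith ω.ρ (ω.supp t) p).card : ℝ) - m / Fintype.card (Pattern ℓ b)| ≤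
      η * (m / Fintype.card (Pattern ℓ b))) :
    |ω.stepMean m a c t - drift ℓ b m a c * ω.contrast m a c t| ≤
      (ℓ * Fintype.card (Pattern ℓ b) : ℝ) *
        (6 + 3 * η * √(m / Fintype.card (Pattern ℓ b) : ℝ) +
          12 * (ℓ * Fintype.card (Pattern ℓ b) : ℝ)) := by
  obtain ⟨C, hC⟩ := exists_abs_step_le.{u} n ℓ b
  have hP : 0 < (Fintype.card (Pattern ℓ b) : ℝ) := Nat.cast_pos.2 Fintype.card_pos
  have hm : 0 < (m : ℝ) := Nat.cast_pos.2 H.m_pos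
  have hb : 0 < (b : ℝ) := Nat.cast_pos.2 H.b_pos
  have hℓ' : 1 ≤ (ℓ : ℝ) := Nat.one_le_cast.2 hℓ
  have hs := shiftSize_pos (ℓ := ℓ) (b := b)
  have hσ := H.scale_pos
  have hσ2 : scale m b ^ 2 = m / b := Real.sq_sqrt (by positivity)
  have hca : 0 < c + a := by linarith [H.a_pos, H.a_lt]
  set E := (ℓ * Fintype.card (Pattern ℓ b) : ℝ) *
        (6 + 3 * η * √(m / Fintype.card (Pattern ℓ b) : ℝ) +
          12 * (ℓ * Fintype.card (Pattern ℓ b) : ℝ)) with hE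
  have hE0 : 0 ≤ E := by positivity
  have h := abs_integral_shift_sub_le (ω.meanResponse t)
    (fun x => 𝔼 z, (ω.resample t (z, x)).step t) (ω.intervalIntegrable_meanResponse t)
    (intervalIntegrable_of_bounded (ω.measurable_expect_step t) C fun x =>
      (Finset.abs_expect_le _ _).trans
        (Finset.expect_le Finset.univ_nonempty fun z _ => hC _ _ _ _))
    (shiftSize ℓ b) (a * scale m b) ((c + 2 * a) * scale m b)
    (m / Fintype.card (Pattern ℓ b)) (2 * ℓ) E H.lt.le ?_
  · have e1 : (∫ x in ((c + 2 * a) * scale m b - shiftSize ℓ b)..(c + 2 * a) * scale m b,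
        ω.meanResponse t x) - (∫ x in (a * scale m b - shiftSize ℓ b)..a * scale m b,
          ω.meanResponse t x) = 2 * shiftSize ℓ b * ω.contrast m a c t := by
      unfold Run.contrast
      field_simp
    have e2 : (∫ x in (a * scale m b)..(c + 2 * a) * scale m b,
        𝔼 z, (ω.resample t (z, x)).step t) = (c + a) * scale m b * ω.stepMean m a c t := by
      rw [Run.stepMean_eq H]
      field_simp
    rw [e1, e2] at h
    have e3 : m / Fintype.card (Pattern ℓ b) * (2 * shiftSize ℓ b * ω.contrast m a c t) -
        2 * ℓ * ((c + a) * scale m b * ω.stepMean m a c t) =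
        -(2 * ℓ * ((c + a) * scale m b)) *
          (ω.stepMean m a c t - drift ℓ b m a c * ω.contrast m a c t) := by
      have : m / Fintype.card (Pattern ℓ b) * shiftSize ℓ b = 2 * scale m b ^ 2 := by
        rw [hσ2, shiftSize]; field_simp
      have h2 : ℓ * (c + a) * drift ℓ b m a c = 2 * scale m b := by
        rw [drift]; field_simp
      linear_combination 2 * ω.contrast m a c t * this -
        2 * scale m b * ω.contrast m a c t * h2
    rw [e3, abs_mul, abs_neg, abs_of_pos (by positivity)] at h
    -- The common interval length cancels; the remaining factor 2ℓ ≥ 1 is given away.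
    have h4 : (c + a) * scale m b * (2 * ℓ *
        |ω.stepMean m a c t - drift ℓ b m a c * ω.contrast m a c t|) ≤
        (c + a) * scale m b * E := by linarith
    have h5 := le_of_mul_le_mul_left h4 (by positivity)
    have := abs_nonneg (ω.stepMean m a c t - drift ℓ b m a c * ω.contrast m a c t)
    nlinarith
  · intro x
    have h := abs_smoothed_sub_expect_avgAdjusted_le hℓ ω.ρ ω.h (ω.supp t) (ω.keyEstimator t)
      (ω.abs_keyEstimator_le t) (m / Fintype.card (Pattern ℓ b)) η (by positivity) hη0 hη hbal
      (x • (patternOf ω.ρ ω.h).vec)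
    rw [← sub_smul] at h
    simp only [Run.meanResponse, Run.s_resample, Run.step_resample]
    exact h

/-! ### Correctness of the algorithm -/

lemma Run.s_setVal (ω : Run A) (t : Fin r) (x : ℝ) : (ω.setVal t x).s t =
    if ω.h ∈ (ω.setVal t x).response t then 1 else -1 := rfl

/-- Fixing the value at `x` leaves the signs of query `t` random, and averaging them again does not
change the integral. The right side is the mean of a ±1 variable. -/
lemma integral_meanResponse (H : Admissible n b m r a c) (t : Fin r) (x : ℝ) :
    ∫ ω : Run A, ω.meanResponse t x ∂(runLaw A m a c) = 2 * reportProb A m a c t x - 1 := by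
  have := H.isProbabilityMeasure_runLaw (A := A)
  have := H.isProbabilityMeasure_stepLaw
  have hset : ∀ ω : Run A, ω.setVal t x = ω.resample t (ω.sign t, x) := fun ω => by
    simp [Run.setVal, Run.resample]
  have hm : Measurable fun ω : Run A => (ω.setVal t x).s t := by
    simp_rw [hset]
    exact (Run.measurable_s t).comp ((measurable_resample t).comp
      (f := fun ω : Run A => (ω, ω.sign t, x)) (by fun_prop))
  have e1 : ∫ ω : Run A, (ω.setVal t x).s t ∂(runLaw A m a c) =
      ∫ ω : Run A, ω.meanResponse t x ∂(runLaw A m a c) := by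
    rw [← integral_resample H t hm 1 fun ω => (Run.abs_s _ t).le]
    refine integral_congr_ae (Filter.Eventually.of_forall fun ω => ?_)
    have e : ∀ y, ((ω.resample t y).setVal t x).s t = (ω.resample t (y.1, x)).s t := fun y => by
      simp [Run.setVal, Run.resample]
    simp_rw [e]
    have := isProbabilityMeasure_cond_Icc H.lt
    unfold stepLaw
    rw [integral_fun_fst (fun z => (ω.resample t (z, x)).s t), integral_uniformOn_univ]
    simp [Run.meanResponse]
  have hS : MeasurableSet {ω : Run A | ω.h ∈ (ω.setVal t x).response t} := by
    have : {ω : Run A | ω.h ∈ (ω.setVal t x).response t} =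
        (fun ω : Run A => (ω.setVal t x).s t) ⁻¹' {1} := by
      ext ω
      rw [mem_preimage, mem_singleton_iff, Run.s_setVal]
      by_cases h : ω.h ∈ (ω.setVal t x).response t
      · simp [h]
      · simp only [mem_ofPred_eq, h, if_false, false_iff]; norm_num
    rw [this]
    exact hm (measurableSet_singleton 1)
  rw [← e1, reportProb, ← integral_indicator_one hS]
  have hi : Integrable ({ω : Run A | ω.h ∈ (ω.setVal t x).response t}.indicator (1 : Run A → ℝ))
      (runLaw A m a c) := (integrable_const (1 : ℝ)).indicator hS
  rw [← integral_const_mul, show (1 : ℝ) = ∫ ω, (1 : ℝ) ∂(runLaw A m a c) by simp,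
    ← integral_sub (by simpa using hi.const_mul 2) (integrable_const _)]
  refine integral_congr_ae (Filter.Eventually.of_forall fun ω => ?_)
  dsimp only
  rw [Run.s_setVal]
  by_cases h : ω.h ∈ (ω.setVal t x).response t
  · simp [h]; norm_num
  · simp [h]

lemma integral_intervalIntegral_meanResponse (H : Admissible n b m r a c) (t : Fin r) {x y : ℝ}
    (hxy : x ≤ y) : ∫ ω : Run A, (∫ v in x..y, ω.meanResponse t v) ∂(runLaw A m a c) =
      ∫ v in x..y, (2 * reportProb A m a c t v - 1) := by
  have := H.isProbabilityMeasure_runLaw (A := A)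
  simp_rw [intervalIntegral.integral_of_le hxy, ← integral_meanResponse H]
  exact integral_integral_swap (integrable_of_bounded (Run.measurable_meanResponse t) 1
    fun p => p.1.abs_meanResponse_le t p.2)

/-- The condition s ≤ 2aσ puts the upper window above cσ and the lower window inside [-aσ, aσ]; the
range [aσ, (c + 2a)σ] of the attack leaves exactly this room. Correctness at each point of the
windows gives means of at least 1 - 2δ and at most 2δ - 1. -/
lemma one_sub_le_integral_contrast [NeZero b] (H : Admissible n b m r a c) {δ : ℝ}
    (hA : IsCorrect A m a c δ) (hs : shiftSize ℓ b ≤ 2 * (a * scale m b)) (t : Fin r) :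
    1 - 2 * δ ≤ ∫ ω : Run A, ω.contrast m a c t ∂(runLaw A m a c) := by
  have := H.isProbabilityMeasure_runLaw (A := A)
  have hs0 := shiftSize_pos (ℓ := ℓ) (b := b)
  have hint : ∀ x y : ℝ, Integrable (fun ω : Run A => ∫ v in x..y, ω.meanResponse t v)
      (runLaw A m a c) := by
    intro x y
    have hm := (Run.measurable_meanResponse (A := A) t).stronglyMeasurable
    refine integrable_of_bounded ((hm.integral_prod_right'
      (ν := volume.restrict (Ioc x y))).measurable.sub
      (hm.integral_prod_right' (ν := volume.restrict (Ioc y x))).measurable) |y - x| fun ω => ?_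
    have := intervalIntegral.norm_integral_le_of_norm_le_const (a := x) (b := y)
      (C := 1) (f := ω.meanResponse t) fun x _ => ω.abs_meanResponse_le t x
    simpa using this
  have hrm : ∀ x y : ℝ, IntervalIntegrable (fun v => 2 * reportProb A m a c t v - 1) volume x y := by
    intro x y
    simp_rw [← integral_meanResponse H]
    refine intervalIntegrable_of_bounded ?_ 1 (fun v => ?_) x y
    · have hm := (Run.measurable_meanResponse (A := A) t).stronglyMeasurable
      exact (hm.integral_prod_left' (μ := runLaw A m a c)).measurable
    · have := norm_integral_le_of_norm_le_const (μ := runLaw A m a c) (C := 1)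
        (f := fun ω => ω.meanResponse t v)
        (Filter.Eventually.of_forall fun ω => ω.abs_meanResponse_le t v)
      simpa using this
  unfold Run.contrast
  rw [integral_const_mul, integral_sub (hint _ _) (hint _ _),
    integral_intervalIntegral_meanResponse H t (by linarith),
    integral_intervalIntegral_meanResponse H t (by linarith)]
  have hσ := H.scale_pos
  have h1 : shiftSize ℓ b * (1 - 2 * δ) ≤
      ∫ v in ((c + 2 * a) * scale m b - shiftSize ℓ b)..(c + 2 * a) * scale m b,
        (2 * reportProb A m a c t v - 1) := by
    have := intervalIntegral.integral_mono_on (a := (c + 2 * a) * scale m b - shiftSize ℓ b)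
      (b := (c + 2 * a) * scale m b) (f := fun _ => 1 - 2 * δ)
      (g := fun v => 2 * reportProb A m a c t v - 1) (by linarith) (by simp) (hrm _ _)
      fun v hv => by
        have := (hA t v).1 (by linarith [hv.1])
        linarith
    rw [intervalIntegral.integral_const, smul_eq_mul] at this
    linarith
  have h2 : (∫ v in (a * scale m b - shiftSize ℓ b)..a * scale m b,
        (2 * reportProb A m a c t v - 1)) ≤ shiftSize ℓ b * (2 * δ - 1) := by
    have := intervalIntegral.integral_mono_on (a := a * scale m b - shiftSize ℓ b)
      (b := a * scale m b) (g := fun _ => 2 * δ - 1)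
      (f := fun v => 2 * reportProb A m a c t v - 1) (by linarith) (hrm _ _) (by simp)
      fun v hv => by
        have := (hA t v).2 (abs_le.2 ⟨by linarith [hv.1], hv.2⟩)
        linarith
    rw [intervalIntegral.integral_const, smul_eq_mul] at this
    linarith
  rw [one_div, le_inv_mul_iff₀ (by positivity)]
  linarith

end Contrast

/-! ### Second moments of bounded functions -/

section SecondMoments

variable {Ω : Type*} [MeasurableSpace Ω] {P : Measure Ω} [IsProbabilityMeasure P]

omit [IsProbabilityMeasure P] in
lemma abs_integral_mul_le_sqrt {f g : Ω → ℝ} (hf : MemLp f 2 P) (hg : MemLp g 2 P) :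
    |∫ ω, f ω * g ω ∂P| ≤ √(∫ ω, f ω ^ 2 ∂P) * √(∫ ω, g ω ^ 2 ∂P) := by
  have hfg : Integrable (fun ω => f ω * g ω) P := hf.integrable_mul hg
  have hff := hf.integrable_sq
  have hgg := hg.integrable_sq
  -- The quadratic s ↦ ∫ (f + s g)² is nonnegative, so its discriminant is at most zero.
  have key : ∀ s : ℝ, 0 ≤ (∫ ω, g ω ^ 2 ∂P) * (s * s) + (2 * ∫ ω, f ω * g ω ∂P) * s +
      ∫ ω, f ω ^ 2 ∂P := by
    intro s
    have h : 0 ≤ ∫ ω, (f ω + s * g ω) ^ 2 ∂P := integral_nonneg fun ω => sq_nonneg _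
    have e : ∀ ω, (f ω + s * g ω) ^ 2 = s * s * g ω ^ 2 + 2 * s * (f ω * g ω) + f ω ^ 2 :=
      fun ω => by ring
    simp_rw [e] at h
    rw [integral_add (by exact (hgg.const_mul _).add (hfg.const_mul _)) hff,
      integral_add (hgg.const_mul _) (hfg.const_mul _), integral_const_mul,
      integral_const_mul] at h
    linarith
  have hd := discrim_le_zero key
  rw [discrim] at hd
  rw [← Real.sqrt_mul (integral_nonneg fun ω => sq_nonneg _)]
  refine Real.abs_le_sqrt ?_
  linarith

/-- With Z = W - w the variance equals E[U²] + 2E[UZ] + Var Z, and 0 ≤ Var Z ≤ E[Z²]. The constant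
`w` need not be the mean of W, so the target value r·`drift` can be inserted directly. -/
lemma abs_variance_add_sub_le {U W : Ω → ℝ} (hU : MemLp U 2 P) (hW : MemLp W 2 P)
    (hU0 : ∫ ω, U ω ∂P = 0) (w : ℝ) :
    |variance (fun ω => U ω + W ω) P - ∫ ω, U ω ^ 2 ∂P| ≤
      2 * (√(∫ ω, U ω ^ 2 ∂P) * √(∫ ω, (W ω - w) ^ 2 ∂P)) + ∫ ω, (W ω - w) ^ 2 ∂P := by
  have hZ : MemLp (fun ω => W ω - w) 2 P := hW.sub (memLp_const w)
  have hcs := abs_integral_mul_le_sqrt hU hZ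
  have hUZ : Integrable (fun ω => U ω * (W ω - w)) P := hU.integrable_mul hZ
  have h1 : variance (fun ω => U ω + W ω) P = variance (fun ω => U ω + (W ω - w)) P := by
    have e := variance_sub_const (X := fun ω => U ω + W ω) (hU.add hW).aestronglyMeasurable w
    simpa [add_sub_assoc] using e.symm
  have h2 : variance (fun ω => U ω + (W ω - w)) P = ∫ ω, U ω ^ 2 ∂P +
      2 * (∫ ω, U ω * (W ω - w) ∂P) + variance (fun ω => W ω - w) P := by
    have e1 := variance_eq_sub (hU.add hZ)
    have e2 := variance_eq_sub hZ
    simp only [Pi.pow_apply, Pi.add_apply] at e1 e2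
    have e3 : ∫ ω, (U ω + (W ω - w)) ^ 2 ∂P = ∫ ω, U ω ^ 2 ∂P +
        2 * (∫ ω, U ω * (W ω - w) ∂P) + ∫ ω, (W ω - w) ^ 2 ∂P := by
      have e : ∀ ω, (U ω + (W ω - w)) ^ 2 = U ω ^ 2 + 2 * (U ω * (W ω - w)) + (W ω - w) ^ 2 :=
        fun ω => by ring
      simp_rw [e]
      rw [integral_add (by exact hU.integrable_sq.add (hUZ.const_mul 2)) hZ.integrable_sq,
        integral_add hU.integrable_sq (hUZ.const_mul 2), integral_const_mul]
    rw [integral_add (hU.integrable (by norm_num)) (hZ.integrable (by norm_num)), hU0, zero_add,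
      e3] at e1
    have e4 : variance (fun ω => U ω + (W ω - w)) P = variance (U + fun ω => W ω - w) P := rfl
    rw [e4, e1, e2]; ring
  have h3 : variance (fun ω => W ω - w) P ≤ ∫ ω, (W ω - w) ^ 2 ∂P :=
    variance_le_expectation_sq hZ.aestronglyMeasurable
  have h4 := variance_nonneg (fun ω => W ω - w) P
  rw [h1, h2]
  rw [abs_le] at *
  constructor <;> linarith [hcs.1, hcs.2]

end SecondMoments

/-! ### The error of the conditional means is o(σ) on average. -/

section Deviation

variable {n ℓ b r : ℕ} {A : QueryResponse.{u} n ℓ b r} {m : ℕ} {a c : ℝ}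

/-- The deviation of `stepMean` from a multiple of `contrast`. -/
def Run.deviation (m : ℕ) (a c : ℝ) (ω : Run A) (t : Fin r) : ℝ :=
  ω.stepMean m a c t - drift ℓ b m a c * ω.contrast m a c t

lemma Run.measurable_deviation (H : Admissible n b m r a c) (t : Fin r) :
    Measurable fun ω : Run A => ω.deviation m a c t :=
  (Run.measurable_stepMean H t).sub ((Run.measurable_contrast t).const_mul _)

/-- A bound for `deviation` in units of `scale`. -/
def devBound (ℓ b : ℕ) (a c : ℝ) : ℝ := √(b : ℝ) + 2 / (ℓ * (c + a))

lemma Admissible.sqrt_eq (H : Admissible n b m r a c) :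
    √(m : ℝ) = √(b : ℝ) * scale m b := by
  have hb : 0 < (b : ℝ) := Nat.cast_pos.2 H.b_pos
  rw [scale, ← Real.sqrt_mul hb.le, mul_div_cancel₀ _ hb.ne']

lemma drift_eq : drift ℓ b m a c = 2 / (ℓ * (c + a)) * scale m b := by
  rw [drift]; ring

lemma Admissible.drift_nonneg (H : Admissible n b m r a c) : 0 ≤ drift ℓ b m a c := by
  have := H.scale_pos
  have := H.a_pos
  have : 0 < c := H.a_pos.trans H.a_lt
  unfold drift
  positivity

lemma Run.abs_deviation_le [NeZero b] (hℓ : 0 < ℓ) (H : Admissible n b m r a c) (ω : Run A)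
    (t : Fin r) (hω : (ω.supp t).card = m) :
    |ω.deviation m a c t| ≤ devBound ℓ b a c * scale m b := by
  have h1 := ω.abs_stepMean_le_sqrt hℓ H t hω
  have h2 := ω.abs_contrast_le (m := m) (a := a) (c := c) t
  have h3 : |drift ℓ b m a c * ω.contrast m a c t| ≤ drift ℓ b m a c := by
    rw [abs_mul, abs_of_nonneg H.drift_nonneg]
    exact mul_le_of_le_one_right H.drift_nonneg h2
  refine (abs_sub _ _).trans ?_
  rw [devBound, add_mul, ← drift_eq, ← H.sqrt_eq]
  exact add_le_add h1 h3

lemma tendsto_scale (hb : 0 < b) : Filter.Tendsto (fun m : ℕ => scale m b) Filter.atTop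
    Filter.atTop :=
  Real.tendsto_sqrt_atTop.comp
    (tendsto_natCast_atTop_atTop.atTop_div_const (Nat.cast_pos.2 hb))

/-- For long tails the deviation is small on average, uniformly in all other parameters. -/
lemma eventually_integral_abs_deviation_le [NeZero b] (hℓ : 0 < ℓ) (ha : 0 < a) (hac : a < c)
    {ε : ℝ} (hε : 0 < ε) : ∀ᶠ m : ℕ in Filter.atTop, ∀ (n r : ℕ) (A : QueryResponse.{u} n ℓ b r),
      Admissible n b m r a c → ∀ t, ∫ ω : Run A, |ω.deviation m a c t| ∂(runLaw A m a c) ≤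
        ε * scale m b := by
  have hc : 0 < c := ha.trans hac
  have hb : 0 < b := NeZero.pos b
  have hb' : 0 < (b : ℝ) := Nat.cast_pos.2 hb
  have hℓ' : 0 < (ℓ : ℝ) := Nat.cast_pos.2 hℓ
  obtain ⟨Q, hQ⟩ : ∃ Q : ℝ, Q = Fintype.card (Pattern ℓ b) := ⟨_, rfl⟩
  have hQ1 : 1 ≤ Q := by rw [hQ]; exact_mod_cast Fintype.card_pos
  set M : ℝ := ℓ * Q with hM
  have hM0 : 0 < M := by positivity
  set D := devBound ℓ b a c with hD
  have hD0 : 0 < D := by rw [hD, devBound]; positivity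
  -- Small enough that the error 3Mη√(m/Q) of balanced runs is at most (ε/3)σ, using √m = √b·σ.
  set η : ℝ := min (1 / 2) (ε / (9 * M * √(b : ℝ))) with hη
  have hη0 : 0 < η := lt_min (by norm_num) (by positivity)
  have hη2 : 3 * M * η * √(b : ℝ) ≤ ε / 3 := by
    have : η * (9 * M * √(b : ℝ)) ≤ ε := (le_div_iff₀ (by positivity)).1 (min_le_right _ _)
    linarith
  -- The first threshold makes the constant error M(6 + 12M) at most (ε/3)σ; the second does this
  -- for the contribution of unbalanced runs.
  filter_upwards [(tendsto_scale hb).eventually_ge_atTop (M * (6 + 12 * M) / (ε / 3)),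
    tendsto_natCast_atTop_atTop.eventually_ge_atTop (D * Q ^ 3 / η ^ 2 / (ε / 3))]
    with m hm1 hm2 n r A H t
  have := H.isProbabilityMeasure_runLaw (A := A)
  have hm0 : 0 < (m : ℝ) := Nat.cast_pos.2 H.m_pos
  have hσ := H.scale_pos
  rw [div_le_iff₀ (by positivity)] at hm1 hm2
  -- Chebyshev's inequality in pointwise form: a single unbalanced pattern forces the imbalance to
  -- be at least (ηm/Q)², so the second term dominates the crude bound Dσ there.
  have hpt : ∀ᵐ ω ∂(runLaw A m a c), |ω.deviation m a c t| ≤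
      2 * (ε / 3) * scale m b +
        D * scale m b / (η * (m / Q)) ^ 2 * imbalance ω.ρ (ω.supp t) := by
    filter_upwards [ae_mem_supports H] with ω hω
    have hcard : (ω.supp t).card = m := (hω.1 t).1
    have himb := imbalance_nonneg ω.ρ (ω.supp t)
    by_cases hbal : ∀ p, |((keysWith ω.ρ (ω.supp t) p).card : ℝ) -
        m / Fintype.card (Pattern ℓ b)| ≤ η * (m / Fintype.card (Pattern ℓ b))
    · have h := ω.abs_stepMean_sub_contrast_le hℓ H t η hη0.le (min_le_left _ _) hbal
      rw [← hQ] at h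
      have hsq : √(m / Q) ≤ √(b : ℝ) * scale m b := by
        rw [← H.sqrt_eq]
        exact Real.sqrt_le_sqrt (div_le_self hm0.le hQ1)
      have h1 : 3 * M * η * √(m / Q) ≤ ε / 3 * scale m b := by
        calc 3 * M * η * √(m / Q) ≤ 3 * M * η * (√(b : ℝ) * scale m b) :=
              mul_le_mul_of_nonneg_left hsq (by positivity)
          _ = (3 * M * η * √(b : ℝ)) * scale m b := by ring
          _ ≤ _ := mul_le_mul_of_nonneg_right hη2 hσ.le
      have h2 : 0 ≤ D * scale m b / (η * (m / Q)) ^ 2 * imbalance ω.ρ (ω.supp t) := by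
        positivity
      unfold Run.deviation
      linarith
    · push Not at hbal
      obtain ⟨p, hp⟩ := hbal
      rw [← hQ] at hp
      have h1 : (η * (m / Q)) ^ 2 ≤ imbalance ω.ρ (ω.supp t) := by
        have h2 : (((keysWith ω.ρ (ω.supp t) p).card : ℝ) - m / Q) ^ 2 ≤
            imbalance ω.ρ (ω.supp t) := by
          unfold imbalance
          rw [hcard, ← hQ]
          exact Finset.single_le_sum (f := fun p => (((keysWith ω.ρ (ω.supp t) p).card : ℝ) -
            m / Q) ^ 2) (fun _ _ => sq_nonneg _) (Finset.mem_univ p)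
        refine le_trans ?_ h2
        rw [← sq_abs (((keysWith ω.ρ (ω.supp t) p).card : ℝ) - m / Q)]
        exact pow_le_pow_left₀ (by positivity) hp.le 2
      have h3 := ω.abs_deviation_le hℓ H t hcard
      have h4 : D * scale m b ≤
          D * scale m b / (η * (m / Q)) ^ 2 * imbalance ω.ρ (ω.supp t) := by
        rw [div_mul_eq_mul_div, le_div_iff₀ (by positivity)]
        exact mul_le_mul_of_nonneg_left h1 (by positivity)
      have : 0 ≤ 2 * (ε / 3) * scale m b := by positivity
      linarith
  have hi := Run.integrable_imbalance (A := A) H t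
  have h := integral_mono_of_nonneg (Filter.Eventually.of_forall fun ω : Run A =>
    abs_nonneg (ω.deviation m a c t)) ((integrable_const _).add (hi.const_mul _)) hpt
  refine h.trans ?_
  have e : ∫ ω : Run A, (2 * (ε / 3) * scale m b + D * scale m b / (η * (m / Q)) ^ 2 *
      imbalance ω.ρ (ω.supp t)) ∂(runLaw A m a c) = 2 * (ε / 3) * scale m b +
        D * scale m b / (η * (m / Q)) ^ 2 *
          ∫ ω : Run A, imbalance ω.ρ (ω.supp t) ∂(runLaw A m a c) := by
    rw [integral_add (integrable_const _) (hi.const_mul _), integral_const, probReal_univ,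
      one_smul, integral_const_mul]
  refine e.le.trans ?_
  have h2 := integral_imbalance_le (A := A) H t
  rw [← hQ] at h2
  have h3 : D * scale m b / (η * (m / Q)) ^ 2 *
      ∫ ω : Run A, imbalance ω.ρ (ω.supp t) ∂(runLaw A m a c) ≤ ε / 3 * scale m b := by
    calc _ ≤ D * scale m b / (η * (m / Q)) ^ 2 * (Q * m) :=
          mul_le_mul_of_nonneg_left h2 (by positivity)
      _ = (D * Q ^ 3 / η ^ 2) / m * scale m b := by field_simp
      _ ≤ ε / 3 * scale m b := by
          refine mul_le_mul_of_nonneg_right ?_ hσ.le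
          rw [div_le_iff₀ hm0]; linarith
  linarith

end Deviation

/-! ### The output and fresh sketch randomness -/

section Output

variable {n ℓ b r : ℕ} {A : QueryResponse.{u} n ℓ b r} {m : ℕ} {a c : ℝ}

lemma Run.output_h (ω : Run A) (hω : (ω.h, ω.supp) ∈ supports n m r) : ω.output ω.h = 0 := by
  simp only [Run.output, Finset.sum_apply, Pi.smul_apply]
  exact Finset.sum_eq_zero fun t _ => by simp [Run.tail, (hω.1 t).2]

/-- The supports are disjoint, so all cross terms vanish and the answers disappear from the squares.
-/
lemma Run.sum_output_sq (ω : Run A) (hω : (ω.h, ω.supp) ∈ supports n m r) :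
    ∑ i, ω.output i ^ 2 = r * m := by
  have h : ∀ i, ω.output i ^ 2 = ∑ t, signVec (ω.supp t) (ω.sign t) i ^ 2 := by
    intro i
    simp only [Run.output, Finset.sum_apply, Pi.smul_apply, smul_eq_mul]
    rw [sq, Finset.sum_mul_sum]
    refine Finset.sum_congr rfl fun t _ => ?_
    rw [Finset.sum_eq_single_of_mem t (Finset.mem_univ t)]
    · rw [← sq, mul_pow, Run.s_sq, one_mul]; rfl
    · intro t' _ hne
      by_cases hi : i ∈ ω.supp t
      · have : i ∉ ω.supp t' := Finset.disjoint_left.1 (hω.2 hne.symm) hi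
        simp [Run.tail, this]
      · simp [Run.tail, hi]
  simp_rw [h]
  rw [Finset.sum_comm]
  simp_rw [sum_signVec_sq, fun t => (hω.1 t).1]
  simp

lemma Run.l2norm_output (ω : Run A) (hω : (ω.h, ω.supp) ∈ supports n m r) :
    l2norm ω.output = √((r : ℝ) * m) := by
  rw [l2norm, EuclideanSpace.norm_eq]
  simp only [Real.norm_eq_abs, sq_abs]
  rw [ω.sum_output_sq hω]

lemma measurable_avgAdjusted_output :
    Measurable fun p : Randomness n ℓ b × Run A => avgAdjusted p.1 p.2.h p.2.output := by
  simp_rw [avgAdjusted_output]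
  exact Finset.measurable_fun_sum _ fun t _ =>
    ((Run.measurable_s t).comp measurable_snd).mul (measurable_avgAdjusted_tail t)

lemma exists_abs_avgAdjusted_output_le (A : QueryResponse.{u} n ℓ b r) :
    ∃ C : ℝ, ∀ (ρ : Randomness n ℓ b) (ω : Run A), |avgAdjusted ρ ω.h ω.output| ≤ C := by
  obtain ⟨C, hC⟩ := exists_abs_avgAdjusted_le n ℓ b
  refine ⟨∑ _t : Fin r, C, fun ρ ω => ?_⟩
  rw [avgAdjusted_output]
  refine (Finset.abs_sum_le_sum_abs _ _).trans (Finset.sum_le_sum fun t _ => ?_)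
  rw [abs_mul, Run.abs_s, one_mul]
  exact hC _ _ _ _

/-- Given the run, the output is a fixed vector vanishing at the key, and a fresh sketch is
independent of it. -/
lemma integral_fresh [NeZero b] (H : Admissible n b m r a c) :
    ∫ p : Randomness n ℓ b × Run A, avgAdjusted p.1 p.2.h p.2.output
      ∂((randomnessLaw n ℓ b).prod (runLaw A m a c)) = 0 := by
  have := H.isProbabilityMeasure_runLaw (A := A)
  have := H.isProbabilityMeasure_randomnessLaw (ℓ := ℓ)
  obtain ⟨C, hC⟩ := exists_abs_avgAdjusted_output_le A
  rw [integral_prod_symm _ (integrable_of_bounded measurable_avgAdjusted_output C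
    fun p => hC _ _)]
  refine integral_eq_zero_of_ae ?_
  filter_upwards [ae_mem_supports H] with ω hω
  rw [randomnessLaw, integral_uniformOn_univ]
  exact expect_avgAdjusted _ _ (ω.output_h hω)

lemma integral_fresh_sq [NeZero b] (hℓ : 0 < ℓ) (H : Admissible n b m r a c) :
    ∫ p : Randomness n ℓ b × Run A, avgAdjusted p.1 p.2.h p.2.output ^ 2
      ∂((randomnessLaw n ℓ b).prod (runLaw A m a c)) = r * m / (ℓ * b) := by
  have := H.isProbabilityMeasure_runLaw (A := A)
  have := H.isProbabilityMeasure_randomnessLaw (ℓ := ℓ)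
  obtain ⟨C, hC⟩ := exists_abs_avgAdjusted_output_le A
  rw [integral_prod_symm _ (integrable_of_bounded (measurable_avgAdjusted_output.pow_const 2)
    (C ^ 2) fun p => by rw [abs_pow]; exact pow_le_pow_left₀ (abs_nonneg _) (hC _ _) 2)]
  have h : ∀ᵐ ω ∂(runLaw A m a c), ∫ ρ, avgAdjusted ρ ω.h ω.output ^ 2 ∂(randomnessLaw n ℓ b) =
      r * m / (ℓ * b) := by
    filter_upwards [ae_mem_supports H] with ω hω
    rw [randomnessLaw, integral_uniformOn_univ, expect_avgAdjusted_sq hℓ _ _ (ω.output_h hω),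
      ω.sum_output_sq hω]
  rw [integral_congr_ae h]
  simp

end Output

/-! ### Mean and variance of X in terms of the conditional means. -/

section Moments

variable {n ℓ b r : ℕ} {A : QueryResponse.{u} n ℓ b r} {m : ℕ} {a c : ℝ}

lemma IsCorrect.nonneg {δ : ℝ} (hA : IsCorrect A m a c δ) (ha : 0 ≤ a) (t : Fin r) : 0 ≤ δ :=
  measureReal_nonneg.trans ((hA t 0).2 (by
    rw [abs_zero]; exact mul_nonneg ha (Real.sqrt_nonneg _)))

variable [NeZero b]

lemma integrable_contrast (H : Admissible n b m r a c) (t : Fin r) :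
    Integrable (fun ω : Run A => ω.contrast m a c t) (runLaw A m a c) := by
  have := H.isProbabilityMeasure_runLaw (A := A)
  exact integrable_of_bounded (Run.measurable_contrast t) 1 fun ω => ω.abs_contrast_le t

lemma integrable_abs_deviation (H : Admissible n b m r a c) (t : Fin r) :
    Integrable (fun ω : Run A => |ω.deviation m a c t|) (runLaw A m a c) := by
  have := H.isProbabilityMeasure_runLaw (A := A)
  obtain ⟨C, hC0, hC⟩ := exists_bounds (A := A) H
  refine (integrable_of_bounded (Run.measurable_deviation H t) (C + drift ℓ b m a c)
    fun ω => (abs_sub _ _).trans (add_le_add (hC ω t).2.1 ?_)).abs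
  rw [abs_mul, abs_of_nonneg H.drift_nonneg]
  exact mul_le_of_le_one_right H.drift_nonneg (ω.abs_contrast_le t)

omit [NeZero b] in
lemma Run.stepMean_eq_add (ω : Run A) (t : Fin r) : ω.stepMean m a c t =
    drift ℓ b m a c * ω.contrast m a c t + ω.deviation m a c t := by
  rw [Run.deviation]; ring

/-- Second-moment errors are reduced pointwise to linear ones in `1 - contrast` and `|deviation|`,
the only quantities whose integrals are controlled. -/
lemma integral_le_of_ae_le (H : Admissible n b m r a c) (t : Fin r) {F : Run A → ℝ}
    (hF : ∀ ω, 0 ≤ F ω) (x y z : ℝ)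
    (h : ∀ᵐ ω ∂(runLaw A m a c), F ω ≤ x + y * (1 - ω.contrast m a c t) +
      z * |ω.deviation m a c t|) :
    ∫ ω, F ω ∂(runLaw A m a c) ≤ x + y * (1 - ∫ ω : Run A, ω.contrast m a c t ∂(runLaw A m a c)) +
      z * ∫ ω : Run A, |ω.deviation m a c t| ∂(runLaw A m a c) := by
  have := H.isProbabilityMeasure_runLaw (A := A)
  have i1 := integrable_contrast (A := A) H t
  have i2 := integrable_abs_deviation (A := A) H t
  have i3 : Integrable (fun ω : Run A => y * (1 - ω.contrast m a c t)) (runLaw A m a c) :=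
    ((integrable_const _).sub i1).const_mul y
  have i4 : Integrable (fun ω : Run A => x + y * (1 - ω.contrast m a c t)) (runLaw A m a c) :=
    (integrable_const x).add i3
  refine (integral_mono_of_nonneg (Filter.Eventually.of_forall hF) (i4.add (i2.const_mul z))
    h).trans (le_of_eq ?_)
  have e := integral_add i4 (i2.const_mul z)
  simp only [Pi.add_apply] at e ⊢
  rw [e, integral_add (integrable_const x) i3, integral_const_mul, integral_const_mul,
    integral_sub (integrable_const _) i1]
  simp

variable {δ κ : ℝ}

lemma abs_integral_step_sub_le (H : Admissible n b m r a c) (hA : IsCorrect A m a c δ)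
    (hs : shiftSize ℓ b ≤ 2 * (a * scale m b)) (t : Fin r)
    (hκ : ∫ ω : Run A, |ω.deviation m a c t| ∂(runLaw A m a c) ≤ κ * scale m b) :
    |∫ ω : Run A, ω.step t ∂(runLaw A m a c) - drift ℓ b m a c| ≤
      2 * δ * drift ℓ b m a c + κ * scale m b := by
  have := H.isProbabilityMeasure_runLaw (A := A)
  have i1 := integrable_contrast (A := A) H t
  have i2 : Integrable (fun ω : Run A => ω.deviation m a c t) (runLaw A m a c) :=
    (integrable_abs_deviation (A := A) H t).mono'
      (Run.measurable_deviation H t).aestronglyMeasurable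
      (Filter.Eventually.of_forall fun ω => le_rfl)
  rw [integral_step H]
  simp_rw [Run.stepMean_eq_add]
  rw [integral_add (i1.const_mul _) i2, integral_const_mul]
  have h1 := one_sub_le_integral_contrast H hA hs t
  have h2 : ∫ ω : Run A, ω.contrast m a c t ∂(runLaw A m a c) ≤ 1 := by
    have := integral_mono i1 (integrable_const (1 : ℝ)) fun ω =>
      (abs_le.1 (ω.abs_contrast_le (m := m) (a := a) (c := c) t)).2
    simpa using this
  have h3 := abs_integral_le_integral_abs (f := fun ω : Run A => ω.deviation m a c t)
    (μ := runLaw A m a c)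
  have hd := H.drift_nonneg (ℓ := ℓ)
  rw [abs_le] at *
  constructor <;> nlinarith [h3.1, h3.2]

lemma integral_stepMean_sq_le (hℓ : 0 < ℓ) (H : Admissible n b m r a c) (t : Fin r)
    (hκ : ∫ ω : Run A, |ω.deviation m a c t| ∂(runLaw A m a c) ≤ κ * scale m b) :
    ∫ ω : Run A, ω.stepMean m a c t ^ 2 ∂(runLaw A m a c) ≤ drift ℓ b m a c ^ 2 +
      (2 * drift ℓ b m a c + devBound ℓ b a c * scale m b) * (κ * scale m b) := by
  have hd := H.drift_nonneg (ℓ := ℓ)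
  have hσ := H.scale_pos
  have ha := H.a_pos
  have hc : 0 < c := ha.trans H.a_lt
  have hD : 0 ≤ devBound ℓ b a c := by unfold devBound; positivity
  have h := integral_le_of_ae_le (A := A) H t (F := fun ω => ω.stepMean m a c t ^ 2)
    (fun ω => sq_nonneg _) (drift ℓ b m a c ^ 2) 0
    (2 * drift ℓ b m a c + devBound ℓ b a c * scale m b) ?_
  · refine h.trans ?_
    rw [zero_mul, add_zero]
    gcongr
  · filter_upwards [ae_mem_supports H] with ω hω
    have h1 := ω.abs_deviation_le hℓ H t (hω.1 t).1
    have h2 := ω.abs_contrast_le (m := m) (a := a) (c := c) t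
    rw [Run.stepMean_eq_add]
    set T := ω.contrast m a c t
    set e := ω.deviation m a c t
    set μ := drift ℓ b m a c
    have h3 : T ^ 2 ≤ 1 := (sq_le_one_iff_abs_le_one T).2 h2
    have h4 : T * e ≤ |e| := by
      refine (le_abs_self _).trans ?_
      rw [abs_mul]
      exact mul_le_of_le_one_left (abs_nonneg _) h2
    have h5 : e ^ 2 ≤ devBound ℓ b a c * scale m b * |e| := by
      rw [← sq_abs, sq]
      exact mul_le_mul_of_nonneg_right h1 (abs_nonneg _)
    have h6 := mul_le_mul_of_nonneg_left h3 (sq_nonneg μ)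
    have h7 := mul_le_mul_of_nonneg_left h4 hd
    nlinarith

lemma integral_stepMean_sub_sq_le (hℓ : 0 < ℓ) (H : Admissible n b m r a c)
    (hA : IsCorrect A m a c δ) (hs : shiftSize ℓ b ≤ 2 * (a * scale m b)) (t : Fin r)
    (hκ : ∫ ω : Run A, |ω.deviation m a c t| ∂(runLaw A m a c) ≤ κ * scale m b) :
    ∫ ω : Run A, (ω.stepMean m a c t - drift ℓ b m a c) ^ 2 ∂(runLaw A m a c) ≤
      4 * δ * drift ℓ b m a c ^ 2 +
      (4 * drift ℓ b m a c + devBound ℓ b a c * scale m b) * (κ * scale m b) := by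
  have hd := H.drift_nonneg (ℓ := ℓ)
  have hσ := H.scale_pos
  have ha := H.a_pos
  have hc : 0 < c := ha.trans H.a_lt
  have hD : 0 ≤ devBound ℓ b a c := by unfold devBound; positivity
  have h := integral_le_of_ae_le (A := A) H t
    (F := fun ω => (ω.stepMean m a c t - drift ℓ b m a c) ^ 2)
    (fun ω => sq_nonneg _) 0 (2 * drift ℓ b m a c ^ 2)
    (4 * drift ℓ b m a c + devBound ℓ b a c * scale m b) ?_
  · refine h.trans ?_
    have h1 := one_sub_le_integral_contrast H hA hs t
    rw [zero_add]
    refine add_le_add ?_ ?_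
    · have : 1 - ∫ ω : Run A, ω.contrast m a c t ∂(runLaw A m a c) ≤ 2 * δ := by linarith
      have := mul_le_mul_of_nonneg_left this (sq_nonneg (drift ℓ b m a c))
      linarith
    · gcongr
  · filter_upwards [ae_mem_supports H] with ω hω
    have h1 := ω.abs_deviation_le hℓ H t (hω.1 t).1
    have h2 := ω.abs_contrast_le (m := m) (a := a) (c := c) t
    rw [Run.stepMean_eq_add]
    set T := ω.contrast m a c t
    set e := ω.deviation m a c t
    set μ := drift ℓ b m a c
    obtain ⟨h2a, h2b⟩ := abs_le.1 h2
    -- As |T| ≤ 1, the squared distance from 1 is linear in 1 - T, whose mean is at most 2δ; hence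
    -- the coefficient 4δ.
    have h3 : (T - 1) ^ 2 ≤ 2 * (1 - T) := by nlinarith
    have h4 : (T - 1) * e ≤ 2 * |e| := by
      refine (le_abs_self _).trans ?_
      rw [abs_mul]
      refine mul_le_mul_of_nonneg_right ?_ (abs_nonneg _)
      rw [abs_le]; constructor <;> linarith
    have h5 : e ^ 2 ≤ devBound ℓ b a c * scale m b * |e| := by
      rw [← sq_abs, sq]
      exact mul_le_mul_of_nonneg_right h1 (abs_nonneg _)
    have h6 := mul_le_mul_of_nonneg_left h3 (sq_nonneg μ)
    have h7 := mul_le_mul_of_nonneg_left h4 hd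
    nlinarith

omit [NeZero b] in
lemma integral_output_eq (H : Admissible n b m r a c) :
    ∫ ω : Run A, avgAdjusted ω.ρ ω.h ω.output ∂(runLaw A m a c) =
      ∑ t, ∫ ω : Run A, ω.step t ∂(runLaw A m a c) := by
  have := H.isProbabilityMeasure_runLaw (A := A)
  obtain ⟨C, hC0, hC⟩ := exists_bounds (A := A) H
  simp_rw [avgAdjusted_output]
  exact integral_finsetSum _ fun t _ => integrable_of_bounded (Run.measurable_step t) C
    fun ω => (hC ω t).1

omit [NeZero b] in
lemma memLp_of_bounded {α : Type*} [MeasurableSpace α] {μ : Measure α} [IsFiniteMeasure μ]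
    {F : α → ℝ} (hF : Measurable F) (C : ℝ) (hC : ∀ x, |F x| ≤ C) : MemLp F 2 μ :=
  MemLp.of_bound hF.aestronglyMeasurable C (Filter.Eventually.of_forall hC)

/-- The variance of the average adjusted measurement of the output, in terms of bounds for the
conditional expectations of the contributions of the queries. -/
lemma abs_variance_output_sub_le (hℓ : 0 < ℓ) (H : Admissible n b m r a c) {x y : ℝ}
    (hx : ∀ t, ∫ ω : Run A, ω.stepMean m a c t ^ 2 ∂(runLaw A m a c) ≤ x)
    (hy : ∀ t, ∫ ω : Run A, (ω.stepMean m a c t - drift ℓ b m a c) ^ 2 ∂(runLaw A m a c) ≤ y) :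
    |variance (fun ω : Run A => avgAdjusted ω.ρ ω.h ω.output) (runLaw A m a c) -
        r * (m / (ℓ * b))| ≤
      r * x + 2 * (√(r * (m / (ℓ * b)) : ℝ) * √((r : ℝ) ^ 2 * y)) + (r : ℝ) ^ 2 * y := by
  have := H.isProbabilityMeasure_runLaw (A := A)
  obtain ⟨C, hC0, hC⟩ := exists_bounds (A := A) H
  -- X splits into the martingale part U and the sum W of the conditional means.
  set U := fun ω : Run A => ∑ t, ω.noise m a c t with hUdef
  set W := fun ω : Run A => ∑ t, ω.stepMean m a c t with hWdef
  have hbd : ∀ F : Fin r → ℝ, (∀ t, |F t| ≤ C) → |∑ t, F t| ≤ ∑ _t : Fin r, C := fun F hF =>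
    (Finset.abs_sum_le_sum_abs _ _).trans (Finset.sum_le_sum fun t _ => hF t)
  have hU : MemLp U 2 (runLaw A m a c) := memLp_of_bounded
    (Finset.measurable_fun_sum _ fun t _ => Run.measurable_noise H t) _
    fun ω => hbd _ fun t => (hC ω t).2.2
  have hW : MemLp W 2 (runLaw A m a c) := memLp_of_bounded
    (Finset.measurable_fun_sum _ fun t _ => Run.measurable_stepMean H t) _
    fun ω => hbd _ fun t => (hC ω t).2.1
  have is : ∀ t, Integrable (fun ω : Run A => ω.step t) (runLaw A m a c) := fun t =>
    integrable_of_bounded (Run.measurable_step t) C fun ω => (hC ω t).1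
  have im : ∀ t, Integrable (fun ω : Run A => ω.stepMean m a c t) (runLaw A m a c) := fun t =>
    integrable_of_bounded (Run.measurable_stepMean H t) C fun ω => (hC ω t).2.1
  have hU0 : ∫ ω, U ω ∂(runLaw A m a c) = 0 := by
    rw [hUdef, integral_finsetSum _ fun t _ => by exact (is t).sub (im t)]
    refine Finset.sum_eq_zero fun t _ => ?_
    simp only [Run.noise]
    rw [integral_sub (is t) (im t), integral_step H, sub_self]
  have hX : (fun ω : Run A => avgAdjusted ω.ρ ω.h ω.output) = fun ω => U ω + W ω := by
    funext ω
    rw [avgAdjusted_output, hUdef, hWdef, ← Finset.sum_add_distrib]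
    refine Finset.sum_congr rfl fun t _ => ?_
    rw [Run.noise, Run.step]; ring
  have hv := abs_variance_add_sub_le hU hW hU0 (r * drift ℓ b m a c)
  rw [← hX] at hv
  have hU2 : ∫ ω, U ω ^ 2 ∂(runLaw A m a c) = r * (m / (ℓ * b)) -
      ∑ t, ∫ ω : Run A, ω.stepMean m a c t ^ 2 ∂(runLaw A m a c) := by
    rw [hUdef, integral_sum_noise_sq H, Finset.sum_sub_distrib]
    simp_rw [integral_step_sq hℓ H]
    simp
  have hS0 : 0 ≤ ∑ t, ∫ ω : Run A, ω.stepMean m a c t ^ 2 ∂(runLaw A m a c) :=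
    Finset.sum_nonneg fun t _ => integral_nonneg fun ω => sq_nonneg _
  have hS1 : ∑ t, ∫ ω : Run A, ω.stepMean m a c t ^ 2 ∂(runLaw A m a c) ≤ r * x := by
    simpa using Finset.sum_le_sum fun t (_ : t ∈ Finset.univ) => hx t
  have hW2 : ∫ ω, (W ω - r * drift ℓ b m a c) ^ 2 ∂(runLaw A m a c) ≤ (r : ℝ) ^ 2 * y := by
    -- The conditional means of different steps may be fully correlated, so only Cauchy–Schwarz is
    -- available; this produces r² instead of r and is the source of q.
    have hpt : ∀ ω : Run A, (W ω - r * drift ℓ b m a c) ^ 2 ≤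
        r * ∑ t, (ω.stepMean m a c t - drift ℓ b m a c) ^ 2 := by
      intro ω
      have h := sq_sum_le_card_mul_sum_sq (s := (Finset.univ : Finset (Fin r)))
        (f := fun t => ω.stepMean m a c t - drift ℓ b m a c)
      simpa [Finset.sum_sub_distrib, hWdef] using h
    have i2 : ∀ t, Integrable (fun ω : Run A => (ω.stepMean m a c t - drift ℓ b m a c) ^ 2)
        (runLaw A m a c) := fun t =>
      ((memLp_of_bounded (Run.measurable_stepMean H t) C fun ω => (hC ω t).2.1).sub
        (memLp_const _)).integrable_sq
    have h := integral_mono_of_nonneg (μ := runLaw A m a c)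
      (Filter.Eventually.of_forall fun ω => sq_nonneg (W ω - r * drift ℓ b m a c))
      ((integrable_finsetSum _ fun t _ => i2 t).const_mul (r : ℝ))
      (Filter.Eventually.of_forall hpt)
    rw [integral_const_mul, integral_finsetSum _ fun t _ => i2 t] at h
    refine h.trans ?_
    have h2 := Finset.sum_le_sum fun t (_ : t ∈ Finset.univ) => hy t
    simp only [Finset.sum_const, Finset.card_univ, Fintype.card_fin, nsmul_eq_mul] at h2
    calc (r : ℝ) * _ ≤ r * (r * y) := mul_le_mul_of_nonneg_left h2 (Nat.cast_nonneg r)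
      _ = _ := by ring
  have hs1 : √(∫ ω, U ω ^ 2 ∂(runLaw A m a c)) ≤ √(r * (m / (ℓ * b)) : ℝ) :=
    Real.sqrt_le_sqrt (by linarith)
  have hs2 := Real.sqrt_le_sqrt hW2
  have hs3 := mul_le_mul hs1 hs2 (Real.sqrt_nonneg _) (Real.sqrt_nonneg _)
  rw [abs_le] at *
  constructor <;> linarith [hv.1, hv.2]

end Moments

/-! ### Choosing the accuracy -/

lemma exists_small (x₁ x₂ x₃ x₄ K₁ K₂ : ℝ) (h₁ : 0 < x₁) (h₂ : 0 < x₂) (h₃ : 0 < x₃) (h₄ : 0 < x₄)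
    (hK₁ : 0 < K₁) (hK₂ : 0 < K₂) :
    ∃ κ : ℝ, 0 < κ ∧ K₁ * κ ≤ x₁ ∧ K₁ * κ ≤ x₂ ∧ K₂ * κ ≤ x₃ ∧ κ ≤ x₄ := by
  refine ⟨min (min (x₁ / K₁) (x₂ / K₁)) (min (x₃ / K₂) x₄), ?_, ?_, ?_, ?_, ?_⟩
  · exact lt_min (lt_min (by positivity) (by positivity)) (lt_min (by positivity) h₄)
  · rw [← le_div_iff₀' hK₁]; exact (min_le_left _ _).trans (min_le_left _ _)
  · rw [← le_div_iff₀' hK₁]; exact (min_le_left _ _).trans (min_le_right _ _)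
  · rw [← le_div_iff₀' hK₂]; exact (min_le_right _ _).trans (min_le_left _ _)
  · exact (min_le_right _ _).trans (min_le_right _ _)

/-- The error terms of the variance, collected in units of the variance `v` of a fresh sketch. -/
lemma variance_error_le {v q κ K₁ K₂ ε w : ℝ} (hv : 0 ≤ v) (hq : 0 ≤ q) (hK : 0 ≤ K₁ * κ)
    (h1 : K₁ * κ ≤ (ε / 8) ^ 2) (h2 : K₁ * κ ≤ ε / 4) (h3 : K₂ * κ ≤ ε / 4) (hε : 0 < ε) :
    -- Each of the three summands exceeds its main term by at most vε/4; for the middle one this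
    -- uses √(q² + K₁κ) ≤ q + ε/8.
    v * (w + K₂ * κ) + 2 * (√v * √(v * (q ^ 2 + K₁ * κ))) + v * (q ^ 2 + K₁ * κ) ≤
      (w + 2 * q + q ^ 2 + ε) * v := by
  have hs : √(q ^ 2 + K₁ * κ) ≤ q + ε / 8 := by
    refine Real.sqrt_le_iff.2 ⟨by positivity, ?_⟩
    nlinarith
  have e : √v * √(v * (q ^ 2 + K₁ * κ)) = v * √(q ^ 2 + K₁ * κ) := by
    rw [Real.sqrt_mul hv, ← mul_assoc, Real.mul_self_sqrt hv]
  rw [e]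
  have := mul_le_mul_of_nonneg_left hs hv
  have := mul_le_mul_of_nonneg_left h2 hv
  have := mul_le_mul_of_nonneg_left h3 hv
  have := mul_nonneg hv hε.le
  linarith

end CountSketch

end

/-! ### Assembly of the theorem. -/

theorem mainTheorem1 (ℓ b : ℕ) (hℓ : 0 < ℓ) (hb : 0 < b) (B a c : ℝ) (hB : 1 < B)
    (ha : 0 < a) (hac : a < c) (r : ℕ) (hr : (r : ℝ) = B * (ℓ : ℝ) ^ 2) (ε : ℝ) (hε : 0 < ε) :
    ∃ m₀ : ℕ, ∀ m : ℕ, m₀ ≤ m → ∀ n : ℕ, r * m + 1 ≤ n →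
      ∀ (A : CountSketch.QueryResponse.{u} n ℓ b r) (δ : ℝ), CountSketch.IsCorrect A m a c δ →
        let P : Measure (CountSketch.Run A) := CountSketch.runLaw A m a c
        let X : CountSketch.Run A → ℝ := fun ω => CountSketch.avgAdjusted ω.ρ ω.h ω.output
        let P' : Measure (CountSketch.Randomness n ℓ b × CountSketch.Run A) :=
          (CountSketch.randomnessLaw n ℓ b).prod P
        let X' : CountSketch.Randomness n ℓ b × CountSketch.Run A → ℝ :=
          fun p => CountSketch.avgAdjusted p.1 p.2.h p.2.output
        let q : ℝ := 4 * √(B * ℓ * δ) / (c + a)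
        MemLp X 2 P ∧ MemLp X' 2 P' ∧
        ∀ᵐ ω ∂P,
          ω.output ω.h = 0 ∧
          CountSketch.l2norm ω.output = √((r : ℝ) * m) ∧
          |(∫ ω', X ω' ∂P) - 2 / (c + a) * √(B / b) * CountSketch.l2norm ω.output| ≤
            (2 * δ + ε) * (2 / (c + a) * √(B / b) * CountSketch.l2norm ω.output) ∧
          |variance X P - CountSketch.l2norm ω.output ^ 2 / (ℓ * b)| ≤
            (4 / (ℓ * (c + a) ^ 2) + 2 * q + q ^ 2 + ε) *
              (CountSketch.l2norm ω.output ^ 2 / (ℓ * b)) ∧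
          (∫ p, X' p ∂P') = 0 ∧
          variance X' P' = CountSketch.l2norm ω.output ^ 2 / (ℓ * b) := by
  have : NeZero b := ⟨hb.ne'⟩
  have hc : 0 < c := ha.trans hac
  have hℓ' : 0 < (ℓ : ℝ) := Nat.cast_pos.2 hℓ
  have hb' : 0 < (b : ℝ) := Nat.cast_pos.2 hb
  have hB0 : 0 < B := by linarith
  have hr0 : 0 < (r : ℝ) := by rw [hr]; positivity
  have hrpos : 0 < r := Nat.cast_pos.1 hr0
  set D := CountSketch.devBound ℓ b a c with hD
  have hD0 : 0 < D := by rw [hD, CountSketch.devBound]; positivity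
  set μ' : ℝ := 2 / (ℓ * (c + a)) with hμ'
  have hμ0 : 0 < μ' := by positivity
  -- κ is the allowed mean deviation in units of σ. The two constants are its coefficients, relative
  -- to the fresh variance, in the error of W (factor r²) and in the subtracted squared means
  -- (factor r); the bound εμ' is for the mean.
  obtain ⟨κ, hκ0, hκ1, hκ2, hκ3, hκ4⟩ := CountSketch.exists_small ((ε / 8) ^ 2) (ε / 4) (ε / 4)
    (ε * μ') (r * ℓ * (4 * μ' + D)) (ℓ * (2 * μ' + D)) (by positivity) (by positivity)
    (by positivity) (by positivity) (by positivity) (by positivity)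
  have hev := (CountSketch.eventually_integral_abs_deviation_le.{u} (b := b) hℓ ha hac hκ0).and
    (((CountSketch.tendsto_scale hb).eventually_ge_atTop
      (CountSketch.shiftSize ℓ b / (2 * a))).and (Filter.eventually_gt_atTop 0))
  obtain ⟨m₀, hm₀⟩ := Filter.eventually_atTop.1 hev
  refine ⟨m₀, fun m hm n hn A δ hA => ?_⟩
  obtain ⟨hdev, hs, hmpos⟩ := hm₀ m hm
  have H : CountSketch.Admissible n b m r a c := ⟨hb, hmpos, ha, hac, hn⟩
  replace hdev := hdev n r A H
  replace hs : CountSketch.shiftSize ℓ b ≤ 2 * (a * CountSketch.scale m b) := by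
    rw [div_le_iff₀ (by positivity)] at hs; linarith
  have hδ : 0 ≤ δ := hA.nonneg ha.le ⟨0, hrpos⟩
  have hm0 : 0 < (m : ℝ) := Nat.cast_pos.2 hmpos
  have hσ := H.scale_pos
  have hσ2 : CountSketch.scale m b ^ 2 = m / b := Real.sq_sqrt (by positivity)
  have hμ : CountSketch.drift ℓ b m a c = μ' * CountSketch.scale m b := CountSketch.drift_eq
  set σ := CountSketch.scale m b with hσdef
  have := H.isProbabilityMeasure_runLaw (A := A)
  have := H.isProbabilityMeasure_randomnessLaw (ℓ := ℓ)
  intro P X P' X' q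
  obtain ⟨C, hC⟩ := CountSketch.exists_abs_avgAdjusted_output_le A
  have hX' : MemLp X' 2 P' :=
    CountSketch.memLp_of_bounded CountSketch.measurable_avgAdjusted_output C fun p => hC _ _
  have hX : MemLp X 2 P := CountSketch.memLp_of_bounded
    (CountSketch.measurable_avgAdjusted_output.comp (f := fun ω : CountSketch.Run A => (ω.ρ, ω))
      (by fun_prop)) C fun ω => hC _ _
  have hq0 : 0 ≤ q := by positivity
  -- q² is the bound r²·4δ·`drift`² for the fluctuation of W, divided by the fresh variance rσ²/ℓ.
  have hq2 : q ^ 2 = r * ℓ * (4 * δ * μ' ^ 2) := by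
    simp only [q]
    rw [div_pow, mul_pow, Real.sq_sqrt (by positivity), hr, hμ']
    field_simp
    ring
  have hmain : 2 / (c + a) * √(B / b) * √((r : ℝ) * m) = r * (μ' * σ) := by
    have h1 : √(B / b) * √((r : ℝ) * m) = B * ℓ * σ := by
      rw [← Real.sqrt_mul (by positivity), hr, hσdef, CountSketch.scale,
        show B / b * (B * (ℓ : ℝ) ^ 2 * m) = (B * ℓ) ^ 2 * (m / b) by ring,
        Real.sqrt_mul (by positivity), Real.sqrt_sq (by positivity)]
    rw [mul_assoc, h1, hr, hμ']
    field_simp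
  have hmean : |(∫ ω', X ω' ∂P) - r * (μ' * σ)| ≤ (2 * δ + ε) * (r * (μ' * σ)) := by
    have h1 : ∀ t, |∫ ω, CountSketch.Run.step ω t ∂P - μ' * σ| ≤
        2 * δ * (μ' * σ) + κ * σ := fun t => by
      have := CountSketch.abs_integral_step_sub_le H hA hs t (hdev t)
      rwa [hμ] at this
    have h2 : (∫ ω', X ω' ∂P) - r * (μ' * σ) =
        ∑ t, (∫ ω, CountSketch.Run.step ω t ∂P - μ' * σ) := by
      rw [Finset.sum_sub_distrib, ← CountSketch.integral_output_eq H]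
      simp [X, P]
    rw [h2]
    refine (Finset.abs_sum_le_sum_abs _ _).trans ((Finset.sum_le_sum fun t _ => h1 t).trans ?_)
    rw [Finset.sum_const, Finset.card_univ, Fintype.card_fin, nsmul_eq_mul]
    have := mul_le_mul_of_nonneg_left (mul_le_mul_of_nonneg_right hκ4 hσ.le) hr0.le
    linarith
  have hv : (r : ℝ) * (m / (ℓ * b)) = r * σ ^ 2 / ℓ := by
    rw [hσ2]; field_simp
  have hvar : |variance X P - r * (m / (ℓ * b))| ≤
      (4 / (ℓ * (c + a) ^ 2) + 2 * q + q ^ 2 + ε) * (r * (m / (ℓ * b))) := by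
    have h := CountSketch.abs_variance_output_sub_le (A := A) hℓ H
      (fun t => CountSketch.integral_stepMean_sq_le hℓ H t (hdev t))
      (fun t => CountSketch.integral_stepMean_sub_sq_le hℓ H hA hs t (hdev t))
    refine h.trans ?_
    -- Both error terms are rewritten relative to the fresh variance; the squared drifts give 4/(ℓ(c
    -- + a)²), and the correctness error gives q².
    have e1 : (r : ℝ) * (CountSketch.drift ℓ b m a c ^ 2 +
        (2 * CountSketch.drift ℓ b m a c + D * σ) * (κ * σ)) =
        r * (m / (ℓ * b)) * (4 / (ℓ * (c + a) ^ 2) + ℓ * (2 * μ' + D) * κ) := by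
      have : 4 / (ℓ * (c + a) ^ 2) = ℓ * μ' ^ 2 := by rw [hμ']; field_simp; ring
      rw [hμ, hv, this]
      field_simp
    have e2 : (r : ℝ) ^ 2 * (4 * δ * CountSketch.drift ℓ b m a c ^ 2 +
        (4 * CountSketch.drift ℓ b m a c + D * σ) * (κ * σ)) =
        r * (m / (ℓ * b)) * (q ^ 2 + r * ℓ * (4 * μ' + D) * κ) := by
      rw [hμ, hv, hq2]
      field_simp
    rw [e1, e2]
    exact CountSketch.variance_error_le (by positivity) hq0 (by positivity) hκ1 hκ2 hκ3 hε
  refine ⟨hX, hX', ?_⟩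
  filter_upwards [CountSketch.ae_mem_supports H] with ω hω
  have hn1 := ω.l2norm_output hω
  have hn2 : CountSketch.l2norm ω.output ^ 2 / (ℓ * b) = r * (m / (ℓ * b)) := by
    rw [hn1, Real.sq_sqrt (by positivity)]; ring
  refine ⟨ω.output_h hω, hn1, ?_, ?_, CountSketch.integral_fresh H, ?_⟩
  · rw [hn1, hmain]; exact hmean
  · rw [hn2]; exact hvar
  · rw [variance_eq_sub hX', CountSketch.integral_fresh H, hn2]
    have h := CountSketch.integral_fresh_sq (A := A) hℓ H
    simp only [Pi.pow_apply, X', P', P]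
    rw [h]; ring
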